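/- Let \(\mathcal G\) be a compact metric graph with at least one edge: a finite combinatorial graph with vertex set \(\mathsf V\) and edge set \(\mathsf E\), without loops (parallel edges are allowed), in which every edge \(\mathsf e\) is identified with an interval \([0,\ell_{\mathsf e}]\), \(0<\ell_{\mathsf e}<\infty\). For a vertex \(\mathsf v\) let \(\mathsf E_{\mathsf v}\) be the set of edges incident to \(\mathsf v\), and let \(\partial_{\mathsf e}f(\mathsf v)\) be the outward derivative at \(\mathsf v\) of a function \(f\) along \(\mathsf e\in\mathsf E_{\mathsf v}\), that is, \(-f_{\mathsf e}'(0)\) at the initial and \(f_{\mathsf e}'(\ell_{\mathsf e})\) at the terminal vertex of \(\mathsf e\). Impose at each vertex \(\mathsf v\) one of the following conditions: - standard: \(f\) is continuous in \(\mathsf v\) and \(\sum_{\mathsf e\in\mathsf E_{\mathsf v}}\partial_{\mathsf e}f(\mathsf v)=0\); - Dirichlet: \(f(\mathsf v)=0\); - \(\delta\)-coupling with a real constant \(\alpha_{\mathsf v}\): \(f\) is continuous in \(\mathsf v\) and \(\sum_{\mathsf e\in\mathsf E_{\mathsf v}}\partial_{\mathsf e}f(\mathsf v)=\alpha_{\mathsf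 v}f(\mathsf v)\). Let \(-\Delta\) be the Laplacian, which acts as \(-\frac{\mathrm d^2}{\mathrm dx_{\mathsf e}^2}\) on each edge, on the real functions that are edgewise in \(H^2(0,\ell_{\mathsf e})\) and satisfy these vertex conditions. (a) Suppose that \(\mathcal G\) is a tree and that every vertex carries a standard or a \(\delta\)-coupling condition. Then there are a strictly increasing sequence \((\lambda_k)_{k\in\mathbb N}\) of eigenvalues of \(-\Delta\) of multiplicity one and corresponding eigenfunctions \((\psi_k)_{k\in\mathbb N}\) such that no \(\psi_k\) vanishes at any vertex of \(\mathcal G\). (b) Suppose that \(\mathcal G\) is connected, that at least one vertex carries a Dirichlet condition, that every such vertex has degree one, and that all other vertices carry standard or \(\delta\)-coupling conditions. Then there are a strictly increasing sequence \((\lambda_k)_{k\in\mathbb N}\) of eigenvalues of \(-\Delta\) and corresponding eigenfunctions \((\psi_k)_{k\in\mathbb N}\) with full support, that is, no \(\psi_k\) vanishes identically on any edge of \(\mathcal G\). -/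

import Mathlib

open scoped ContDiff

/-- A compact metric graph: a finite combinatorial multigraph (vertex type `V`, edge type `E`,
finiteness being imposed where it is used) without loops, each edge `e` of which is oriented and
identified with the interval `[0, length e]` of finite positive length; `0` corresponds to the
initial and `length e` to the terminal vertex. Parallel edges are allowed. -/
structure MetricGraph (V E : Type*) where
  /-- initial vertex of an edge -/
  init : E → V
  /-- terminal vertex of an edge -/
  term : E → V
  /-- length of an edge -/
  length : E → ℝ
  length_pos : ∀ e, 0 < length e
  init_ne_term : ∀ e, init e ≠ term e

/-- The vertex conditions: standard (Kirchhoff-Neumann), Dirichlet, and `δ`-coupling with a real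
coupling constant. -/
inductive VertexCondition where
  | standard : VertexCondition
  | dirichlet : VertexCondition
  | delta (α : ℝ) : VertexCondition

/-- `w` is a weak derivative of `u` on the open interval `(0, ℓ)`. -/
def HasWeakDeriv (ℓ : ℝ) (u w : ℝ → ℝ) : Prop :=
  ∀ φ : ℝ → ℝ, ContDiff ℝ ∞ φ → HasCompactSupport φ → tsupport φ ⊆ Set.Ioo 0 ℓ →
    ∫ x in (0 : ℝ)..ℓ, u x * deriv φ x = -∫ x in (0 : ℝ)..ℓ, w x * φ x

theorem HasWeakDeriv.add {ℓ : ℝ} {u₁ u₂ w₁ w₂ : ℝ → ℝ}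
    (h₁ : HasWeakDeriv ℓ u₁ w₁) (h₂ : HasWeakDeriv ℓ u₂ w₂)
    (hu₁ : Continuous u₁) (hu₂ : Continuous u₂) (hw₁ : Continuous w₁) (hw₂ : Continuous w₂) :
    HasWeakDeriv ℓ (fun x => u₁ x + u₂ x) (fun x => w₁ x + w₂ x) := by
  intro φ hφ hc hs
  have hd : Continuous (deriv φ) := hφ.continuous_deriv (by simp)
  have hφc : Continuous φ := hφ.continuous
  have e₁ := h₁ φ hφ hc hs
  have e₂ := h₂ φ hφ hc hs
  simp only [add_mul]
  have a₁ : IntervalIntegrable (fun x => u₁ x * deriv φ x) MeasureTheory.volume 0 ℓ :=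
    (hu₁.mul hd).intervalIntegrable _ _
  have a₂ : IntervalIntegrable (fun x => u₂ x * deriv φ x) MeasureTheory.volume 0 ℓ :=
    (hu₂.mul hd).intervalIntegrable _ _
  have b₁ : IntervalIntegrable (fun x => w₁ x * φ x) MeasureTheory.volume 0 ℓ :=
    (hw₁.mul hφc).intervalIntegrable _ _
  have b₂ : IntervalIntegrable (fun x => w₂ x * φ x) MeasureTheory.volume 0 ℓ :=
    (hw₂.mul hφc).intervalIntegrable _ _
  rw [intervalIntegral.integral_add a₁ a₂, intervalIntegral.integral_add b₁ b₂, e₁, e₂]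
  ring

theorem HasWeakDeriv.const_mul {ℓ : ℝ} {u w : ℝ → ℝ} (h : HasWeakDeriv ℓ u w) (c : ℝ) :
    HasWeakDeriv ℓ (fun x => c * u x) (fun x => c * w x) := by
  intro φ hφ hc hs
  simp only [mul_assoc, intervalIntegral.integral_const_mul]
  rw [h φ hφ hc hs]
  ring

namespace MetricGraph

/-- The underlying simple graph: two distinct vertices are adjacent iff some edge joins them. -/
def skeleton {V E : Type*} (G : MetricGraph V E) : SimpleGraph V :=
  SimpleGraph.fromRel fun v w => ∃ e, G.init e = v ∧ G.term e = w

/-- The metric graph is connected. -/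
def IsConnected {V E : Type*} (G : MetricGraph V E) : Prop :=
  G.skeleton.Connected

/-- The metric graph is a tree: connected, and without cycles. Two parallel edges would form a
cycle, so there are none. -/
def IsTree {V E : Type*} (G : MetricGraph V E) : Prop :=
  G.skeleton.IsTree ∧ Function.Injective fun e => s(G.init e, G.term e)

/-- The set of edges incident to `v`. -/
def edgesAt {V E : Type*} [Fintype E] [DecidableEq V] (G : MetricGraph V E) (v : V) : Finset E :=
  Finset.univ.filter fun e => G.init e = v ∨ G.term e = v

/-- The degree of `v`: the number of edges `v` belongs to. -/
def degree {V E : Type*} [Fintype E] [DecidableEq V] (G : MetricGraph V E) (v : V) : ℕ :=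
  (G.edgesAt v).card

/-- Edgewise continuous real functions: a continuous function on each closed interval
`[0, length e]`. Continuity across vertices is part of the vertex conditions. Functions that are
edgewise in `H¹` or `H²` are represented by their continuous representatives. -/
abbrev EdgeFun {V E : Type*} (G : MetricGraph V E) : Type _ :=
  ∀ e : E, C(Set.Icc (0 : ℝ) (G.length e), ℝ)

/-- The function on the edge `e`, extended to `ℝ` (constantly on both sides); only its values on
`[0, length e]` matter. -/
noncomputable def onEdge {V E : Type*} (G : MetricGraph V E) (ψ : G.EdgeFun) (e : E) : ℝ → ℝ :=
  Set.IccExtend (G.length_pos e).le (ψ e)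

/-- The value at the vertex `v` of the restriction of `ψ` to an edge `e` incident to `v`. -/
noncomputable def valueAt {V E : Type*} [DecidableEq V] (G : MetricGraph V E) (ψ : G.EdgeFun)
    (e : E) (v : V) : ℝ :=
  if G.init e = v then G.onEdge ψ e 0 else G.onEdge ψ e (G.length e)

/-- The outward derivative (pointing out of the edge) at the vertex `v` along an incident edge `e`,
where `dψ` is the edgewise derivative. -/
noncomputable def outwardDeriv {V E : Type*} [DecidableEq V] (G : MetricGraph V E)
    (dψ : G.EdgeFun) (e : E) (v : V) : ℝ :=
  if G.init e = v then -G.onEdge dψ e 0 else G.onEdge dψ e (G.length e)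

/-- `ψ`, with edgewise derivative `dψ`, satisfies the given vertex condition at `v`. For standard
and `δ`-coupling conditions, `c` is the common value `ψ(v)`. -/
def Satisfies {V E : Type*} [Fintype E] [DecidableEq V] (G : MetricGraph V E)
    (ψ dψ : G.EdgeFun) (v : V) : VertexCondition → Prop
  | .standard => ∃ c : ℝ, (∀ e ∈ G.edgesAt v, G.valueAt ψ e v = c) ∧
      ∑ e ∈ G.edgesAt v, G.outwardDeriv dψ e v = 0
  | .dirichlet => ∀ e ∈ G.edgesAt v, G.valueAt ψ e v = 0
  | .delta α => ∃ c : ℝ, (∀ e ∈ G.edgesAt v, G.valueAt ψ e v = c) ∧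
      ∑ e ∈ G.edgesAt v, G.outwardDeriv dψ e v = α * c

/-- `ψ` lies in the domain of the Laplacian `-Δ` with vertex conditions `bc`, and `-Δ ψ = η`.
That is: on each edge, `ψ` is in `H²(0, length e)`, with weak derivative `dψ` (an `H¹` function,
given by its continuous representative) and weak second derivative `-η` in `L²(0, length e)`; and
all vertex conditions hold. -/
def IsLaplacian {V E : Type*} [Fintype E] [DecidableEq V] (G : MetricGraph V E)
    (bc : V → VertexCondition) (ψ : G.EdgeFun) (η : E → ℝ → ℝ) : Prop :=
  (∀ e, MeasureTheory.MemLp (η e) 2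
    (MeasureTheory.volume.restrict (Set.Ioo 0 (G.length e)))) ∧
  ∃ dψ : G.EdgeFun,
    (∀ e, HasWeakDeriv (G.length e) (G.onEdge ψ e) (G.onEdge dψ e)) ∧
    (∀ e, HasWeakDeriv (G.length e) (G.onEdge dψ e) (fun x => -η e x)) ∧
    ∀ v, G.Satisfies ψ dψ v (bc v)

theorem onEdge_add {V E : Type*} (G : MetricGraph V E) (ψ χ : G.EdgeFun) (e : E) (x : ℝ) :
    G.onEdge (ψ + χ) e x = G.onEdge ψ e x + G.onEdge χ e x := rfl

theorem onEdge_smul {V E : Type*} (G : MetricGraph V E) (c : ℝ) (ψ : G.EdgeFun) (e : E) (x : ℝ) :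
    G.onEdge (c • ψ) e x = c * G.onEdge ψ e x := rfl

theorem continuous_onEdge {V E : Type*} (G : MetricGraph V E) (ψ : G.EdgeFun) (e : E) :
    Continuous (G.onEdge ψ e) :=
  (ψ e).continuous.Icc_extend'

theorem memLp_onEdge {V E : Type*} (G : MetricGraph V E) (ψ : G.EdgeFun) (e : E) (c : ℝ) :
    MeasureTheory.MemLp (fun x => c * G.onEdge ψ e x) 2
      (MeasureTheory.volume.restrict (Set.Ioo 0 (G.length e))) := by
  have hc : Continuous fun x => c * G.onEdge ψ e x := continuous_const.mul (G.continuous_onEdge ψ e)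
  obtain ⟨C, hC⟩ := (isCompact_Icc (a := (0 : ℝ)) (b := G.length e)).exists_bound_of_continuousOn
    hc.continuousOn
  refine MeasureTheory.MemLp.of_bound hc.aestronglyMeasurable C ?_
  filter_upwards [MeasureTheory.ae_restrict_mem measurableSet_Ioo] with x hx
  exact hC x (Set.Ioo_subset_Icc_self hx)

theorem valueAt_add {V E : Type*} [DecidableEq V] (G : MetricGraph V E) (ψ χ : G.EdgeFun) (e : E)
    (v : V) : G.valueAt (ψ + χ) e v = G.valueAt ψ e v + G.valueAt χ e v := by
  unfold valueAt; split_ifs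
  · rfl
  · rfl

theorem valueAt_smul {V E : Type*} [DecidableEq V] (G : MetricGraph V E) (c : ℝ) (ψ : G.EdgeFun)
    (e : E) (v : V) : G.valueAt (c • ψ) e v = c * G.valueAt ψ e v := by
  unfold valueAt; split_ifs
  · rfl
  · rfl

theorem outwardDeriv_add {V E : Type*} [DecidableEq V] (G : MetricGraph V E) (ψ χ : G.EdgeFun)
    (e : E) (v : V) :
    G.outwardDeriv (ψ + χ) e v = G.outwardDeriv ψ e v + G.outwardDeriv χ e v := by
  unfold outwardDeriv; split_ifs <;> simp only [onEdge_add]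
  ring

theorem outwardDeriv_smul {V E : Type*} [DecidableEq V] (G : MetricGraph V E) (c : ℝ)
    (ψ : G.EdgeFun) (e : E) (v : V) :
    G.outwardDeriv (c • ψ) e v = c * G.outwardDeriv ψ e v := by
  unfold outwardDeriv; split_ifs <;> simp only [onEdge_smul]
  ring

theorem Satisfies.add {V E : Type*} [Fintype E] [DecidableEq V] {G : MetricGraph V E}
    {ψ dψ χ dχ : G.EdgeFun} {v : V} {b : VertexCondition}
    (h₁ : G.Satisfies ψ dψ v b) (h₂ : G.Satisfies χ dχ v b) :
    G.Satisfies (ψ + χ) (dψ + dχ) v b := by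
  cases b with
  | standard =>
    obtain ⟨c, hc, hs⟩ := h₁
    obtain ⟨d, hd, ht⟩ := h₂
    refine ⟨c + d, fun e he => by rw [valueAt_add, hc e he, hd e he], ?_⟩
    simp only [outwardDeriv_add, Finset.sum_add_distrib, hs, ht, add_zero]
  | dirichlet =>
    intro e he
    rw [valueAt_add, h₁ e he, h₂ e he, add_zero]
  | delta α =>
    obtain ⟨c, hc, hs⟩ := h₁
    obtain ⟨d, hd, ht⟩ := h₂
    refine ⟨c + d, fun e he => by rw [valueAt_add, hc e he, hd e he], ?_⟩
    simp only [outwardDeriv_add, Finset.sum_add_distrib, hs, ht, mul_add]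

theorem Satisfies.smul {V E : Type*} [Fintype E] [DecidableEq V] {G : MetricGraph V E}
    {ψ dψ : G.EdgeFun} {v : V} {b : VertexCondition} (h : G.Satisfies ψ dψ v b) (r : ℝ) :
    G.Satisfies (r • ψ) (r • dψ) v b := by
  cases b with
  | standard =>
    obtain ⟨c, hc, hs⟩ := h
    refine ⟨r * c, fun e he => by rw [valueAt_smul, hc e he], ?_⟩
    simp only [outwardDeriv_smul, ← Finset.mul_sum, hs, mul_zero]
  | dirichlet =>
    intro e he
    rw [valueAt_smul, h e he, mul_zero]
  | delta α =>
    obtain ⟨c, hc, hs⟩ := h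
    refine ⟨r * c, fun e he => by rw [valueAt_smul, hc e he], ?_⟩
    simp only [outwardDeriv_smul, ← Finset.mul_sum, hs]
    ring

/-- The eigenspace of the Laplacian `-Δ` with vertex conditions `bc` for the real number `lam`:
all `ψ` in the domain with `-Δ ψ = lam ψ`. -/
noncomputable def eigenspace {V E : Type*} [Fintype E] [DecidableEq V] (G : MetricGraph V E)
    (bc : V → VertexCondition) (lam : ℝ) : Submodule ℝ G.EdgeFun where
  carrier := {ψ | G.IsLaplacian bc ψ fun e x => lam * G.onEdge ψ e x}
  add_mem' := by
    rintro ψ χ ⟨-, dψ, h₁, h₂, h₃⟩ ⟨-, dχ, k₁, k₂, k₃⟩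
    refine ⟨fun e => G.memLp_onEdge _ e lam, dψ + dχ, fun e => ?_, fun e => ?_,
      fun v => (h₃ v).add (k₃ v)⟩
    · exact (h₁ e).add (k₁ e) (G.continuous_onEdge _ e) (G.continuous_onEdge _ e)
        (G.continuous_onEdge _ e) (G.continuous_onEdge _ e)
    · have := (h₂ e).add (k₂ e) (G.continuous_onEdge _ e) (G.continuous_onEdge _ e)
        (continuous_const.mul (G.continuous_onEdge _ e)).neg
        (continuous_const.mul (G.continuous_onEdge _ e)).neg
      convert this using 2 with x x
      · rfl
      change -(lam * (G.onEdge ψ e x + G.onEdge χ e x)) = -(lam * _) + -(lam * _)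
      ring
  zero_mem' := by
    have h0 : ∀ e x, G.onEdge (0 : G.EdgeFun) e x = 0 := fun e x => rfl
    refine ⟨fun e => G.memLp_onEdge _ e lam, 0, fun e φ _ _ _ => ?_, fun e φ _ _ _ => ?_,
      fun v => ?_⟩
    · simp [h0]
    · simp [h0]
    · cases bc v with
      | standard => exact ⟨0, fun e _ => by simp [valueAt, h0], by simp [outwardDeriv, h0]⟩
      | dirichlet => simp [Satisfies, valueAt, h0]
      | delta α => exact ⟨0, fun e _ => by simp [valueAt, h0], by simp [outwardDeriv, h0]⟩
  smul_mem' := by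
    rintro c ψ ⟨-, dψ, h₁, h₂, h₃⟩
    refine ⟨fun e => G.memLp_onEdge _ e lam, c • dψ, fun e => (h₁ e).const_mul c, fun e => ?_,
      fun v => (h₃ v).smul c⟩
    convert (h₂ e).const_mul c using 2 with x x
    · rfl
    change -(lam * (c * G.onEdge ψ e x)) = c * -(lam * G.onEdge ψ e x)
    ring

/-- `ψ` is an eigenfunction of `-Δ` for the eigenvalue `lam`. -/
def IsEigenfunction {V E : Type*} [Fintype E] [DecidableEq V] (G : MetricGraph V E)
    (bc : V → VertexCondition) (lam : ℝ) (ψ : G.EdgeFun) : Prop :=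
  ψ ∈ G.eigenspace bc lam ∧ ψ ≠ 0

/-- The multiplicity of `lam`: the dimension of its eigenspace. -/
noncomputable def multiplicity {V E : Type*} [Fintype E] [DecidableEq V] (G : MetricGraph V E)
    (bc : V → VertexCondition) (lam : ℝ) : ℕ :=
  Module.finrank ℝ (G.eigenspace bc lam)

/-- `ψ` does not vanish at the vertex `v`. -/
def NonzeroAt {V E : Type*} [Fintype E] [DecidableEq V] (G : MetricGraph V E)
    (ψ : G.EdgeFun) (v : V) : Prop :=
  ∀ e ∈ G.edgesAt v, G.valueAt ψ e v ≠ 0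

/-- `ψ` has full support: it does not vanish identically on any edge. -/
def HasFullSupport {V E : Type*} (G : MetricGraph V E) (ψ : G.EdgeFun) : Prop :=
  ∀ e, ∃ x, ψ e x ≠ 0

end MetricGraph

/-! For `k > 0` the functions in the eigenspace of `k ^ 2` are `A cos(kx) + B sin(kx)` on each edge,
so the eigenvalue problem is linear algebra whose coefficients depend only on the phases `k * length
e` modulo `2π` and on the coupling constants divided by `k`. By recurrence there are arbitrarily
large `s` with all `s * length e` close to `2πℤ`. Near such an `s` the problem is a small
perturbation of the one at low frequency with standard conditions in place of `δ`-couplings. That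
model has positive solutions, which persist. Since the eigenvalues found are arbitrarily large, a
strictly increasing sequence can be extracted.

(a) The model here is the constant function at frequency zero. Near `2πℤ` the end values of an edge
solution stop determining it, so the mean flow `b` is kept as an unknown beside the vertex values
`u`. With the half-angle tangent `t`, the equations are `u (term) - u (init) = 2 t b` and a flux
balance at each vertex. On a tree, prescribing `u r = 1` instead of the balance at a root `r` gives
a system that is invertible at `t = 0` (`IsTree.rootedSystem_zero_injective`), hence nearby, with
`u` close to `1`. The missing root balance equals the sum of all balances, in which the flows
cancel. Its sign is opposite to that of the tangents, so it changes as `k` crosses `s`, and the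
intermediate value theorem gives an eigenvalue. It is simple because the rooted system is injective.

(b) For phases in `(0, π)`, eliminating the edges leaves a quadratic form in the vertex values with
off-diagonal coefficients `-1 / sin < 0`. At small frequencies it is positive definite, thanks to
the Dirichlet vertices. Just before the longest edge reaches phase `π` it takes a negative value.
Both facts survive the shift by `s`. Where definiteness is lost there is a null vector, which may be
replaced by its absolute value, as in the Perron-Frobenius theorem. By connectedness it is positive
off the Dirichlet vertices (`IsConnected.exists_pos_kernel`), so the eigenfunction is nonzero on
every edge with a non-Dirichlet end. An edge without such an end is the whole graph, and sines serve
there. -/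

open Filter Topology

/-! ### Weak derivatives and the equation `u'' = -k² u` on an interval -/

/-- A compact subset of an open interval lies in a closed subinterval. -/
theorem IsCompact.exists_Icc_of_subset_Ioo {K : Set ℝ} (hK : IsCompact K) {ℓ : ℝ} (hℓ : 0 < ℓ)
    (hs : K ⊆ Set.Ioo 0 ℓ) : ∃ a b, 0 < a ∧ b < ℓ ∧ K ⊆ Set.Icc a b := by
  have hK' : IsCompact (insert (ℓ / 2) K) := hK.insert _
  have hne : (insert (ℓ / 2) K).Nonempty := Set.insert_nonempty _ _
  have hs' : insert (ℓ / 2) K ⊆ Set.Ioo 0 ℓ :=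
    Set.insert_subset ⟨by linarith, by linarith⟩ hs
  exact ⟨_, _, (hs' (hK'.sInf_mem hne)).1, (hs' (hK'.sSup_mem hne)).2, fun x hx =>
    ⟨csInf_le hK'.bddBelow (Set.mem_insert_of_mem _ hx),
      le_csSup hK'.bddAbove (Set.mem_insert_of_mem _ hx)⟩⟩

/-- A test function of mean zero is the derivative of a test function. -/
theorem exists_testFunction_deriv_eq {ℓ : ℝ} (hℓ : 0 < ℓ) {g : ℝ → ℝ} (hg : ContDiff ℝ ∞ g)
    (hc : HasCompactSupport g) (hs : tsupport g ⊆ Set.Ioo 0 ℓ) (h0 : ∫ x in (0 : ℝ)..ℓ, g x = 0) :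
    ∃ φ : ℝ → ℝ, ContDiff ℝ ∞ φ ∧ HasCompactSupport φ ∧ tsupport φ ⊆ Set.Ioo 0 ℓ ∧
      deriv φ = g := by
  obtain ⟨a, b, ha, hb, hab⟩ := hc.isCompact.exists_Icc_of_subset_Ioo hℓ hs
  have hgc : Continuous g := hg.continuous
  have hgz : ∀ x, x ∉ Set.Icc a b → g x = 0 := fun x hx =>
    image_eq_zero_of_notMem_tsupport fun h => hx (hab h)
  have hd : ∀ x, HasDerivAt (fun x => ∫ y in (0 : ℝ)..x, g y) (g x) x := fun x =>
    hgc.integral_hasStrictDerivAt 0 x |>.hasDerivAt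
  have hderiv : deriv (fun x => ∫ y in (0 : ℝ)..x, g y) = g := funext fun x => (hd x).deriv
  have hz : ∀ x, x ∉ Set.Icc a b → ∫ y in (0 : ℝ)..x, g y = 0 := by
    intro x hx
    rcases lt_or_ge x a with h | h
    · refine intervalIntegral.integral_zero_ae (Eventually.of_forall fun y hy => hgz y fun hy' => ?_)
      rcases le_total 0 x with h1 | h1
      · rw [Set.uIoc_of_le h1] at hy; linarith [hy.2, hy'.1]
      · rw [Set.uIoc_of_ge h1] at hy; linarith [hy.2, hy'.1]
    · have hbx : b < x := by
        by_contra h'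
        exact hx ⟨h, not_lt.1 h'⟩
      -- To the right of the support the primitive equals the full integral over `(0, ℓ)`, which is
      -- zero.
      rw [← intervalIntegral.integral_add_adjacent_intervals
        (hgc.intervalIntegrable 0 ℓ) (hgc.intervalIntegrable ℓ x), h0, zero_add]
      refine intervalIntegral.integral_zero_ae (Eventually.of_forall fun y hy => hgz y fun hy' => ?_)
      rcases le_total ℓ x with h1 | h1
      · rw [Set.uIoc_of_le h1] at hy; linarith [hy.1, hy'.2]
      · rw [Set.uIoc_of_ge h1] at hy; linarith [hy.1, hy'.2]
  have hsub : tsupport (fun x => ∫ y in (0 : ℝ)..x, g y) ⊆ Set.Icc a b := by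
    refine closure_minimal (fun x hx => ?_) isClosed_Icc
    by_contra h
    exact hx (hz x h)
  refine ⟨fun x => ∫ y in (0 : ℝ)..x, g y, ?_, ?_, ?_, hderiv⟩
  · rw [contDiff_infty_iff_deriv, hderiv]
    exact ⟨fun x => (hd x).differentiableAt, hg⟩
  · exact HasCompactSupport.of_support_subset_isCompact isCompact_Icc (subset_closure.trans hsub)
  · exact hsub.trans fun x hx => ⟨ha.trans_le hx.1, hx.2.trans_lt hb⟩

/-- **Du Bois-Reymond lemma**: a continuous function with zero weak derivative is constant. -/
theorem HasWeakDeriv.eq_const {ℓ : ℝ} (hℓ : 0 < ℓ) {u : ℝ → ℝ} (hu : Continuous u)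
    (h : HasWeakDeriv ℓ u fun _ => 0) : ∀ x ∈ Set.Icc 0 ℓ, u x = u 0 := by
  have hmid : Set.Ioo 0 ℓ ∈ 𝓝 (ℓ / 2) := Ioo_mem_nhds (by linarith) (by linarith)
  obtain ⟨η, hηs, hηc, hη, hηr, hη1⟩ := exists_contDiff_tsupport_subset (n := ⊤) hmid
  have hη' : Continuous η := hη.continuous
  have hIη : 0 < ∫ x in (0 : ℝ)..ℓ, η x := by
    refine intervalIntegral.integral_pos hℓ hη.continuous.continuousOn
      (fun x _ => (hηr ⟨x, rfl⟩).1) ⟨ℓ / 2, ⟨by linarith, by linarith⟩, by rw [hη1]; norm_num⟩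
  set I := ∫ x in (0 : ℝ)..ℓ, η x with hI
  set c := (∫ x in (0 : ℝ)..ℓ, u x * η x) / I with hc
  have key : ∀ g : ℝ → ℝ, ContDiff ℝ ∞ g → HasCompactSupport g → tsupport g ⊆ Set.Ioo 0 ℓ →
      ∫ x, g x • (u x - c) = 0 := by
    intro g hg hgc hgs
    have hgc' : Continuous g := hg.continuous
    have ii : ∀ f : ℝ → ℝ, Continuous f →
        IntervalIntegrable f MeasureTheory.volume 0 ℓ := fun f hf => hf.intervalIntegrable _ _
    set J := ∫ x in (0 : ℝ)..ℓ, g x with hJ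
    -- Subtracting `J / I * η` makes the mean of `g` zero, so the result is the derivative of a test
    -- function and `h` applies. This yields `∫ u g = c J`.
    have hsm : ContDiff ℝ ∞ fun x => g x - J / I * η x := hg.sub (contDiff_const.mul hη)
    have hsupp : tsupport (fun x => g x - J / I * η x) ⊆ tsupport g ∪ tsupport η := by
      refine closure_minimal (fun x hx => ?_)
        ((isClosed_tsupport g).union (isClosed_tsupport η))
      by_contra hx'
      rw [Set.mem_union, not_or] at hx'
      refine hx ?_
      simp [image_eq_zero_of_notMem_tsupport hx'.1, image_eq_zero_of_notMem_tsupport hx'.2]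
    obtain ⟨φ, hφ, hφc, hφs, hφd⟩ := exists_testFunction_deriv_eq hℓ hsm
      (HasCompactSupport.of_support_subset_isCompact (hgc.isCompact.union hηc.isCompact)
        (subset_closure.trans hsupp)) (hsupp.trans (Set.union_subset hgs hηs)) (by
        rw [intervalIntegral.integral_sub (ii g hg.continuous)
          (ii (fun x => J / I * η x) (by fun_prop)), intervalIntegral.integral_const_mul]
        field_simp
        ring)
    have e := h φ hφ hφc hφs
    rw [hφd] at e
    simp only [zero_mul, intervalIntegral.integral_zero, neg_zero] at e
    have hsplit : ∫ x in (0 : ℝ)..ℓ, u x * (g x - J / I * η x)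
        = (∫ x in (0 : ℝ)..ℓ, u x * g x) - J / I * ∫ x in (0 : ℝ)..ℓ, u x * η x := by
      rw [← intervalIntegral.integral_const_mul, ← intervalIntegral.integral_sub
        (ii (fun x => u x * g x) (by fun_prop)) (ii (fun x => J / I * (u x * η x)) (by fun_prop))]
      congr 1; ext x; ring
    have hglob : ∫ x, g x • (u x - c) = ∫ x in (0 : ℝ)..ℓ, g x * (u x - c) := by
      rw [intervalIntegral.integral_of_le hℓ.le, ← MeasureTheory.integral_indicator measurableSet_Ioc]
      congr 1
      ext x
      by_cases hx : x ∈ Set.Ioc 0 ℓ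
      · rw [Set.indicator_of_mem hx, smul_eq_mul]
      · rw [Set.indicator_of_notMem hx, image_eq_zero_of_notMem_tsupport fun h' =>
          hx (Set.Ioo_subset_Ioc_self (hgs h')), zero_smul]
    have hsplit' : ∫ x in (0 : ℝ)..ℓ, g x * (u x - c)
        = (∫ x in (0 : ℝ)..ℓ, u x * g x) - c * J := by
      rw [hJ, ← intervalIntegral.integral_const_mul, ← intervalIntegral.integral_sub
        (ii (fun x => u x * g x) (by fun_prop)) (ii (fun x => c * g x) (by fun_prop))]
      congr 1; ext x; ring
    rw [hglob, hsplit']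
    rw [hsplit] at e
    rw [hc]
    linear_combination e
  have hae := isOpen_Ioo.ae_eq_zero_of_integral_contDiff_smul_eq_zero (U := Set.Ioo 0 ℓ)
    (μ := MeasureTheory.volume) (f := fun x => u x - c)
    ((hu.sub continuous_const).locallyIntegrable.locallyIntegrableOn _) key
  have hIoo : Set.EqOn (fun x => u x - c) (fun _ => 0) (Set.Ioo 0 ℓ) := by
    refine MeasureTheory.Measure.eqOn_open_of_ae_eq (μ := MeasureTheory.volume) ?_ isOpen_Ioo
      (hu.sub continuous_const).continuousOn continuousOn_const
    exact (MeasureTheory.ae_restrict_iff' measurableSet_Ioo).2 hae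
  have hIcc : Set.EqOn (fun x => u x - c) (fun _ => 0) (Set.Icc 0 ℓ) := by
    rw [← closure_Ioo hℓ.ne]
    exact hIoo.closure (hu.sub continuous_const) continuous_const
  intro x hx
  have h1 := hIcc hx
  have h2 := hIcc (Set.left_mem_Icc.2 hℓ.le)
  simp only at h1 h2
  linarith

/-- A function with a classical continuous derivative has it as a weak derivative. -/
theorem HasWeakDeriv.of_hasDerivAt {ℓ : ℝ} (hℓ : 0 < ℓ) {f f' u w : ℝ → ℝ}
    (hf : ∀ x, HasDerivAt f (f' x) x) (hf' : Continuous f')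
    (hu : ∀ x ∈ Set.Icc 0 ℓ, u x = f x) (hw : ∀ x ∈ Set.Icc 0 ℓ, w x = f' x) :
    HasWeakDeriv ℓ u w := by
  intro φ hφ hc hs
  have hfc : Continuous f := continuous_iff_continuousAt.2 fun x => (hf x).continuousAt
  have e1 : ∫ x in (0 : ℝ)..ℓ, u x * deriv φ x = ∫ x in (0 : ℝ)..ℓ, f x * deriv φ x :=
    intervalIntegral.integral_congr fun x hx => by
      rw [Set.uIcc_of_le hℓ.le] at hx
      simp only [hu x hx]
  have e2 : ∫ x in (0 : ℝ)..ℓ, w x * φ x = ∫ x in (0 : ℝ)..ℓ, f' x * φ x :=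
    intervalIntegral.integral_congr fun x hx => by
      rw [Set.uIcc_of_le hℓ.le] at hx
      simp only [hw x hx]
  have hφ' : Continuous (deriv φ) := hφ.continuous_deriv (by simp)
  have h0 : φ 0 = 0 := image_eq_zero_of_notMem_tsupport fun h => lt_irrefl _ (hs h).1
  have h1 : φ ℓ = 0 := image_eq_zero_of_notMem_tsupport fun h => lt_irrefl _ (hs h).2
  rw [e1, e2, intervalIntegral.integral_mul_deriv_eq_deriv_mul_of_hasDerivAt hfc.continuousOn
    hφ.continuous.continuousOn (fun x _ => hf x)
    (fun x _ => (hφ.differentiable (by simp) x).hasDerivAt)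
    (hf'.intervalIntegrable _ _) (hφ'.intervalIntegrable _ _), h0, h1]
  ring

/-- A continuous function with a continuous weak derivative is a primitive of it. -/
theorem HasWeakDeriv.eq_integral {ℓ : ℝ} (hℓ : 0 < ℓ) {u w : ℝ → ℝ} (hu : Continuous u)
    (hw : Continuous w) (h : HasWeakDeriv ℓ u w) :
    ∀ x ∈ Set.Icc 0 ℓ, u x = u 0 + ∫ y in (0 : ℝ)..x, w y := by
  have hd : ∀ x, HasDerivAt (fun x => ∫ y in (0 : ℝ)..x, w y) (w x) x := fun x =>
    hw.integral_hasStrictDerivAt 0 x |>.hasDerivAt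
  have hUc : Continuous fun x => ∫ y in (0 : ℝ)..x, w y :=
    continuous_iff_continuousAt.2 fun x => (hd x).continuousAt
  have h2 := (HasWeakDeriv.of_hasDerivAt hℓ hd hw (fun x _ => rfl) fun x _ => rfl).const_mul (-1)
  have h3 := h.add h2 hu (continuous_const.mul hUc) hw (continuous_const.mul hw)
  have h4 : HasWeakDeriv ℓ (fun x => u x + -1 * ∫ y in (0 : ℝ)..x, w y) fun _ => 0 := by
    convert h3 using 2 with x
    ring
  intro x hx
  have := h4.eq_const hℓ (by fun_prop) x hx
  have h0 : ∫ y in (0 : ℝ)..0, w y = 0 := intervalIntegral.integral_same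
  linarith

/-- One-sided, since at `0` nothing is known about `u` to the left; the criterion for constancy used
next needs only right derivatives. -/
theorem HasWeakDeriv.hasDerivWithinAt {ℓ : ℝ} (hℓ : 0 < ℓ) {u w : ℝ → ℝ} (hu : Continuous u)
    (hw : Continuous w) (h : HasWeakDeriv ℓ u w) {x : ℝ} (hx : x ∈ Set.Ico 0 ℓ) :
    HasDerivWithinAt u (w x) (Set.Ici x) x := by
  have hd : HasDerivAt (fun x => u 0 + ∫ y in (0 : ℝ)..x, w y) (w x) x :=
    (hw.integral_hasStrictDerivAt 0 x |>.hasDerivAt).const_add _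
  refine hd.hasDerivWithinAt.congr_of_eventuallyEq ?_
    (h.eq_integral hℓ hu hw x (Set.Ico_subset_Icc_self hx))
  filter_upwards [Icc_mem_nhdsGE hx.2] with y hy
  exact h.eq_integral hℓ hu hw y ⟨hx.1.trans hy.1, hy.2⟩

/-- The solutions of `u'' = -k² u`, in the weak sense, are combinations of sine and cosine. -/
theorem HasWeakDeriv.eq_cos_add_sin {ℓ k : ℝ} (hℓ : 0 < ℓ) (hk : 0 < k) {u w : ℝ → ℝ}
    (hu : Continuous u) (hw : Continuous w) (h₁ : HasWeakDeriv ℓ u w)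
    (h₂ : HasWeakDeriv ℓ w fun x => -(k ^ 2 * u x)) {x : ℝ} (hx : x ∈ Set.Icc 0 ℓ) :
    u x = u 0 * Real.cos (k * x) + w 0 / k * Real.sin (k * x) ∧
      w x = w 0 * Real.cos (k * x) - k * u 0 * Real.sin (k * x) := by
  have hw' : Continuous fun x => -(k ^ 2 * u x) := (continuous_const.mul hu).neg
  have hcos : ∀ y, HasDerivAt (fun y => Real.cos (k * y)) (-Real.sin (k * y) * k) y := fun y => by
    simpa using ((hasDerivAt_id y).const_mul k).cos
  have hsin : ∀ y, HasDerivAt (fun y => Real.sin (k * y)) (Real.cos (k * y) * k) y := fun y => by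
    simpa using ((hasDerivAt_id y).const_mul k).sin
  have hcc : Continuous fun y => Real.cos (k * y) := by fun_prop
  have hsc : Continuous fun y => Real.sin (k * y) := by fun_prop
  -- The vector `(k u, w)` rotates with angular speed `k`. Undoing the rotation gives two constants
  -- of motion, `hp` and `hq`; rotating these back gives the formulas.
  have hp := constant_of_has_deriv_right_zero (f := fun y =>
    k * u y * Real.cos (k * y) - w y * Real.sin (k * y)) (a := 0) (b := ℓ)
    (((continuous_const.mul hu).mul hcc).sub (hw.mul hsc)).continuousOn (fun y hy => by
      have a := ((((h₁.hasDerivWithinAt hℓ hu hw hy).const_mul k).mul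
        (hcos y).hasDerivWithinAt).sub ((h₂.hasDerivWithinAt hℓ hw hw' hy).mul
        (hsin y).hasDerivWithinAt))
      refine a.congr_deriv ?_
      ring) x hx
  have hq := constant_of_has_deriv_right_zero (f := fun y =>
    k * u y * Real.sin (k * y) + w y * Real.cos (k * y)) (a := 0) (b := ℓ)
    (((continuous_const.mul hu).mul hsc).add (hw.mul hcc)).continuousOn (fun y hy => by
      have a := ((((h₁.hasDerivWithinAt hℓ hu hw hy).const_mul k).mul
        (hsin y).hasDerivWithinAt).add ((h₂.hasDerivWithinAt hℓ hw hw' hy).mul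
        (hcos y).hasDerivWithinAt))
      refine a.congr_deriv ?_
      ring) x hx
  simp only [mul_zero, Real.cos_zero, Real.sin_zero, mul_one, sub_zero, zero_add] at hp hq
  have hcs := Real.sin_sq_add_cos_sq (k * x)
  constructor
  · have : k * u x = k * (u 0 * Real.cos (k * x) + w 0 / k * Real.sin (k * x)) := by
      have e : k * (u 0 * Real.cos (k * x) + w 0 / k * Real.sin (k * x))
        = k * u 0 * Real.cos (k * x) + w 0 * Real.sin (k * x) := by field_simp
      rw [e]
      linear_combination Real.cos (k * x) * hp + Real.sin (k * x) * hq - k * u x * hcs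
    exact mul_left_cancel₀ hk.ne' this
  · linear_combination -Real.sin (k * x) * hp + Real.cos (k * x) * hq - w x * hcs

/-! ### Eigenfunctions as edgewise trigonometric functions -/

namespace MetricGraph

/-- The coupling constant of a vertex condition, `0` for standard conditions. -/
def coupling : VertexCondition → ℝ
  | .delta α => α
  | _ => 0

/-- A standard condition is a `δ`-coupling with constant `0`, so the two need not be distinguished
any more. -/
theorem satisfies_iff {V E : Type*} [Fintype E] [DecidableEq V] (G : MetricGraph V E)
    (ψ dψ : G.EdgeFun) (v : V) {b : VertexCondition} (hb : b ≠ .dirichlet) :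
    G.Satisfies ψ dψ v b ↔ ∃ c : ℝ, (∀ e ∈ G.edgesAt v, G.valueAt ψ e v = c) ∧
      ∑ e ∈ G.edgesAt v, G.outwardDeriv dψ e v = coupling b * c := by
  cases b with
  | standard => simp [Satisfies, coupling]
  | dirichlet => exact absurd rfl hb
  | delta α => rfl

/-- The function `A cos(kx) + B sin(kx)` on each edge. -/
noncomputable def mode {V E : Type*} (G : MetricGraph V E) (k : ℝ) (A B : E → ℝ) : G.EdgeFun :=
  fun e => ⟨fun x => A e * Real.cos (k * x) + B e * Real.sin (k * x), by fun_prop⟩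

theorem onEdge_mode {V E : Type*} (G : MetricGraph V E) (k : ℝ) (A B : E → ℝ) (e : E) {x : ℝ}
    (hx : x ∈ Set.Icc 0 (G.length e)) :
    G.onEdge (G.mode k A B) e x = A e * Real.cos (k * x) + B e * Real.sin (k * x) := by
  rw [onEdge, Set.IccExtend_of_mem _ _ hx]
  rfl

theorem valueAt_mode {V E : Type*} [DecidableEq V] (G : MetricGraph V E) (k : ℝ) (A B : E → ℝ)
    (e : E) (v : V) : G.valueAt (G.mode k A B) e v = if G.init e = v then A e else
      A e * Real.cos (k * G.length e) + B e * Real.sin (k * G.length e) := by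
  rw [valueAt, onEdge_mode _ _ _ _ _ (Set.left_mem_Icc.2 (G.length_pos e).le),
    onEdge_mode _ _ _ _ _ (Set.right_mem_Icc.2 (G.length_pos e).le)]
  simp

/-- The derivative of a mode is the mode with coefficients `k B` and `-k A`. Pulling out the common
factor `k` is what turns a coupling constant `α` into `α / k` later. -/
theorem outwardDeriv_mode {V E : Type*} [DecidableEq V] (G : MetricGraph V E) (k : ℝ)
    (A B : E → ℝ) (e : E) (v : V) :
    G.outwardDeriv (G.mode k (k • B) (-(k • A))) e v = k * if G.init e = v then -B e else
      B e * Real.cos (k * G.length e) - A e * Real.sin (k * G.length e) := by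
  rw [outwardDeriv, onEdge_mode _ _ _ _ _ (Set.left_mem_Icc.2 (G.length_pos e).le),
    onEdge_mode _ _ _ _ _ (Set.right_mem_Icc.2 (G.length_pos e).le)]
  split_ifs
  · simp
  · simp
    ring

theorem mode_mem_eigenspace {V E : Type*} [Fintype E] [DecidableEq V] (G : MetricGraph V E)
    (bc : V → VertexCondition) (k : ℝ) (A B : E → ℝ)
    (h : ∀ v, G.Satisfies (G.mode k A B) (G.mode k (k • B) (-(k • A))) v (bc v)) :
    G.mode k A B ∈ G.eigenspace bc (k ^ 2) := by
  have hcos : ∀ y, HasDerivAt (fun y => Real.cos (k * y)) (-Real.sin (k * y) * k) y := fun y => by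
    simpa using ((hasDerivAt_id y).const_mul k).cos
  have hsin : ∀ y, HasDerivAt (fun y => Real.sin (k * y)) (Real.cos (k * y) * k) y := fun y => by
    simpa using ((hasDerivAt_id y).const_mul k).sin
  have key : ∀ a b y, HasDerivAt (fun y => a * Real.cos (k * y) + b * Real.sin (k * y))
      (k * b * Real.cos (k * y) + -(k * a) * Real.sin (k * y)) y := fun a b y =>
    (((hcos y).const_mul a).add ((hsin y).const_mul b)).congr_deriv (by ring)
  refine ⟨fun e => G.memLp_onEdge _ e _, G.mode k (k • B) (-(k • A)), fun e => ?_, fun e => ?_, h⟩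
  · exact HasWeakDeriv.of_hasDerivAt (G.length_pos e) (key (A e) (B e)) (by fun_prop)
      (fun x hx => G.onEdge_mode k A B e hx) (fun x hx => G.onEdge_mode k _ _ e hx)
  · refine HasWeakDeriv.of_hasDerivAt (G.length_pos e) (key (k * B e) (-(k * A e))) (by fun_prop)
      (fun x hx => G.onEdge_mode k _ _ e hx) (fun x hx => ?_)
    simp only [G.onEdge_mode k _ _ e hx]
    ring

/-- The coefficients are read off at the initial vertex: `A` is the value there and `B` the
derivative divided by `k`. -/
theorem exists_eq_mode {V E : Type*} [Fintype E] [DecidableEq V] (G : MetricGraph V E)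
    (bc : V → VertexCondition) {k : ℝ} (hk : 0 < k) {ψ : G.EdgeFun}
    (hψ : ψ ∈ G.eigenspace bc (k ^ 2)) : ∃ A B : E → ℝ, ψ = G.mode k A B ∧
      ∀ v, G.Satisfies (G.mode k A B) (G.mode k (k • B) (-(k • A))) v (bc v) := by
  obtain ⟨-, dψ, h₁, h₂, h₃⟩ := hψ
  have key := fun e x (hx : x ∈ Set.Icc 0 (G.length e)) =>
    HasWeakDeriv.eq_cos_add_sin (G.length_pos e) hk (G.continuous_onEdge ψ e)
      (G.continuous_onEdge dψ e) (h₁ e) (h₂ e) hx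
  have hval : ∀ (χ : G.EdgeFun) e (x : Set.Icc 0 (G.length e)), χ e x = G.onEdge χ e x :=
    fun χ e x => (Set.IccExtend_val _ _ x).symm
  have e₁ : ψ = G.mode k (fun e => G.onEdge ψ e 0) fun e => G.onEdge dψ e 0 / k := by
    funext e
    ext x
    rw [hval, hval, onEdge_mode _ _ _ _ _ x.2, (key e x x.2).1]
  have e₂ : dψ = G.mode k (k • fun e => G.onEdge dψ e 0 / k) (-(k • fun e => G.onEdge ψ e 0)) := by
    funext e
    ext x
    rw [hval, hval, onEdge_mode _ _ _ _ _ x.2, (key e x x.2).2]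
    simp only [Pi.smul_apply, Pi.neg_apply, smul_eq_mul]
    field_simp
    ring
  refine ⟨_, _, e₁, fun v => ?_⟩
  rw [← e₁, ← e₂]
  exact h₃ v

end MetricGraph

/-! ### Recurrence of phases and stability of linear systems -/

/-- Simultaneous approximation: arbitrarily large multiples bring finitely many phases close to
`2πℤ`. -/
theorem exists_phases_near_zero {E : Type*} [Fintype E] (ℓ : E → ℝ) {δ : ℝ} (hδ : 0 < δ) (K : ℝ) :
    ∃ s, K ≤ s ∧ ∀ e, ∃ m : ℤ, |s * ℓ e - m * (2 * Real.pi)| < δ := by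
  have hpi := Real.two_pi_pos
  set K' := max K 0
  let F : ℕ → E → ℝ := fun n e => Int.fract (n * K' * ℓ e / (2 * Real.pi))
  obtain ⟨a, -, σ, hσ, hlim⟩ := (isCompact_Icc (a := (0 : E → ℝ)) (b := 1)).tendsto_subseq
    (x := F) fun n => ⟨fun e => Int.fract_nonneg _, fun e => (Int.fract_lt_one _).le⟩
  have hcau := hlim.cauchySeq
  obtain ⟨N, hN⟩ := Metric.cauchySeq_iff'.1 hcau (δ / (2 * Real.pi)) (by positivity)
  have hd := hN (N + 1) (Nat.le_succ N)
  have hlt : σ N < σ (N + 1) := hσ (Nat.lt_succ_self N)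
  have h1 : (1 : ℝ) ≤ (σ (N + 1) : ℝ) - σ N := by
    have : (σ N : ℝ) + 1 ≤ σ (N + 1) := by exact_mod_cast hlt
    linarith
  -- Two terms of a convergent subsequence in the unit cube have nearly the same fractional parts,
  -- so the difference of their multiples of `K'` has phases near `2πℤ`. The indices differ by at
  -- least `1`, which gives the lower bound.
  refine ⟨((σ (N + 1) : ℝ) - σ N) * K', ?_, fun e => ?_⟩
  · exact (le_max_left K 0).trans (le_mul_of_one_le_left (le_max_right K 0) h1)
  · refine ⟨⌊σ (N + 1) * K' * ℓ e / (2 * Real.pi)⌋ - ⌊σ N * K' * ℓ e / (2 * Real.pi)⌋, ?_⟩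
    have h2 := (dist_pi_lt_iff (by positivity)).1 hd e
    rw [Real.dist_eq, lt_div_iff₀ hpi] at h2
    have h3 : ∀ y : ℝ, |y| * (2 * Real.pi) = |y * (2 * Real.pi)| := fun y => by
      rw [abs_mul, abs_of_pos hpi]
    rw [h3] at h2
    refine lt_of_eq_of_lt (congrArg _ ?_) h2
    change _ = (Int.fract (σ (N + 1) * K' * ℓ e / (2 * Real.pi)) -
      Int.fract (σ N * K' * ℓ e / (2 * Real.pi))) * (2 * Real.pi)
    rw [Int.fract, Int.fract]
    push_cast
    field_simp
    ring

/-- A property of real numbers that holds for arbitrarily large ones holds along a strictly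
increasing sequence. -/
theorem exists_strictMono_of_unbounded {P : ℝ → Prop} (h : ∀ K, ∃ x, K < x ∧ P x) :
    ∃ x : ℕ → ℝ, StrictMono x ∧ ∀ n, P (x n) := by
  choose f hf hP using h
  let x : ℕ → ℝ := fun n => Nat.rec (f 0) (fun _ y => f y) n
  refine ⟨x, strictMono_nat_of_lt_succ fun n => hf (x n), fun n => ?_⟩
  cases n with
  | zero => exact hP 0
  | succ n => exact hP (x n)

/-- A uniquely solvable linear system remains so under small perturbations, and its solution
depends continuously on the perturbation. -/
theorem exists_continuousAt_solution {T X : Type*} [TopologicalSpace T] [NormedAddCommGroup X]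
    [NormedSpace ℝ X] [FiniteDimensional ℝ X] (L : T → X →ₗ[ℝ] X)
    (hL : ∀ x, Continuous fun τ => L τ x) {τ₀ : T} (h₀ : Function.Injective (L τ₀)) (y : X) :
    ∃ x : T → X, ∀ᶠ τ in 𝓝 τ₀,
      ContinuousAt x τ ∧ L τ (x τ) = y ∧ Function.Injective (L τ) := by
  have : CompleteSpace X := FiniteDimensional.complete ℝ X
  let M : T → X →L[ℝ] X := fun τ => LinearMap.toContinuousLinearMap (L τ)
  have hM : Continuous M := continuous_clm_apply.2 hL
  -- Units of the Banach algebra of operators form an open set on which inversion is continuous.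
  have hu : IsUnit (M τ₀) := by
    rw [ContinuousLinearMap.isUnit_iff_bijective]
    exact ⟨h₀, LinearMap.injective_iff_surjective.1 h₀⟩
  refine ⟨fun τ => Ring.inverse (M τ) y, ?_⟩
  filter_upwards [hM.continuousAt.eventually (Units.isOpen.mem_nhds hu)] with τ hτ
  obtain ⟨a, ha⟩ : IsUnit (M τ) := hτ
  refine ⟨?_, ?_, ?_⟩
  · have h1 : ContinuousAt Ring.inverse (M τ) := by
      rw [← ha]; exact NormedRing.inverse_continuousAt a
    have h2 : ContinuousAt (fun τ => Ring.inverse (M τ)) τ := h1.comp hM.continuousAt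
    exact h2.clm_apply continuousAt_const
  · change (M τ) (Ring.inverse (M τ) y) = y
    rw [← mul_apply_eq_comp, Ring.mul_inverse_cancel _ ⟨a, ha⟩,
      one_apply_eq_self]
  · exact ((ContinuousLinearMap.isUnit_iff_bijective (f := M τ)).1 ⟨a, ha⟩).1

/-! ### Balance equations and the rooted system on a tree -/

namespace MetricGraph

section

variable {V E : Type*}

theorem skeleton_adj_iff (G : MetricGraph V E) {v w : V} : G.skeleton.Adj v w ↔
    ∃ e, (G.init e = v ∧ G.term e = w) ∨ (G.init e = w ∧ G.term e = v) := by
  rw [skeleton, SimpleGraph.fromRel_adj, ← exists_or]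
  refine ⟨And.right, fun h => ⟨?_, h⟩⟩
  obtain ⟨e, ⟨rfl, rfl⟩ | ⟨rfl, rfl⟩⟩ := h
  · exact G.init_ne_term e
  · exact (G.init_ne_term e).symm

/-- A property that passes along edges holds at all vertices of a connected graph. -/
theorem IsConnected.forall_vertex {G : MetricGraph V E} (hG : G.IsConnected) {P : V → Prop}
    (h₁ : ∀ e, P (G.init e) → P (G.term e)) (h₂ : ∀ e, P (G.term e) → P (G.init e)) {r : V}
    (hr : P r) (v : V) : P v := by
  obtain ⟨p⟩ := hG.preconnected r v
  induction p with
  | nil => exact hr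
  | cons hadj p ih =>
    refine ih ?_
    obtain ⟨e, ⟨rfl, rfl⟩ | ⟨rfl, rfl⟩⟩ := G.skeleton_adj_iff.1 hadj
    · exact h₁ e hr
    · exact h₂ e hr

/-- Without parallel edges, edges correspond bijectively to those of the skeleton, which is a tree
in the combinatorial sense. -/
theorem IsTree.card_vertices [Fintype V] [Fintype E] {G : MetricGraph V E} (hG : G.IsTree) :
    Fintype.card V = Fintype.card E + 1 := by
  classical
  rw [← hG.1.card_edgeFinset, SimpleGraph.edgeFinset_card, add_left_inj]
  symm
  refine Fintype.card_of_bijective (f := fun e : E => (⟨s(G.init e, G.term e),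
    G.skeleton_adj_iff.2 ⟨e, .inl ⟨rfl, rfl⟩⟩⟩ : G.skeleton.edgeSet)) ⟨fun e f hef => ?_, ?_⟩
  · exact hG.2 (congrArg Subtype.val hef)
  · rintro ⟨z, hz⟩
    induction z using Sym2.ind with
    | _ v w =>
      obtain ⟨e, ⟨rfl, rfl⟩ | ⟨rfl, rfl⟩⟩ := G.skeleton_adj_iff.1 hz
      · exact ⟨e, rfl⟩
      · exact ⟨e, Subtype.ext Sym2.eq_swap⟩

variable [Fintype E] [DecidableEq V]

theorem mem_edgesAt (G : MetricGraph V E) {v : V} {e : E} :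
    e ∈ G.edgesAt v ↔ G.init e = v ∨ G.term e = v := by
  simp [edgesAt]

/-- Double counting: in the absence of loops each edge is met at two different vertices. -/
theorem sum_sum_edgesAt [Fintype V] (G : MetricGraph V E) (g : E → V → ℝ) :
    ∑ v, ∑ e ∈ G.edgesAt v, g e v = ∑ e, (g e (G.init e) + g e (G.term e)) := by
  simp only [edgesAt, Finset.sum_filter]
  rw [Finset.sum_comm]
  refine Finset.sum_congr rfl fun e _ => ?_
  rw [← Finset.sum_filter, ← Finset.sum_pair (f := g e) (G.init_ne_term e)]
  congr 1
  ext v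
  simp [eq_comm]

/-- The total outward flux at `v`, minus `ε v * u v`, of the edgewise solutions with vertex values
`u`, flows `b` and half-angle tangents `t`. -/
noncomputable def vertexBalance (G : MetricGraph V E) (t : E → ℝ) (ε : V → ℝ) (u : V → ℝ) (b : E → ℝ)
    (v : V) : ℝ :=
  ∑ e ∈ G.edgesAt v, (-(t e * ((u (G.init e) + u (G.term e)) / 2)) +
    if G.init e = v then -b e else b e) - ε v * u v

/-- What flows out at one end of an edge flows in at the other, so `b` cancels. This evaluates the
root balance once all other balances vanish. -/
theorem sum_vertexBalance [Fintype V] (G : MetricGraph V E) (t : E → ℝ) (ε : V → ℝ) (u : V → ℝ)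
    (b : E → ℝ) : ∑ v, G.vertexBalance t ε u b v =
      -∑ e, t e * (u (G.init e) + u (G.term e)) - ∑ v, ε v * u v := by
  simp only [vertexBalance, Finset.sum_sub_distrib]
  rw [G.sum_sum_edgesAt fun e v => (-(t e * ((u (G.init e) + u (G.term e)) / 2)) +
    if G.init e = v then -b e else b e), ← Finset.sum_neg_distrib]
  congr 1
  refine Finset.sum_congr rfl fun e _ => ?_
  rw [if_pos rfl, if_neg (G.init_ne_term e)]
  ring

/-- The linear system for the vertex values `u` and the flows `b`, with the balance at the root `r`
replaced by prescribing `u r`. -/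
noncomputable def rootedSystem (G : MetricGraph V E) (r : V) (τ : (E → ℝ) × (V → ℝ)) :
    ((V → ℝ) × (E → ℝ)) →ₗ[ℝ] ((V → ℝ) × (E → ℝ)) where
  toFun x := (fun v => if v = r then x.1 r else G.vertexBalance τ.1 τ.2 x.1 x.2 v,
    fun e => x.1 (G.term e) - x.1 (G.init e) - 2 * τ.1 e * x.2 e)
  map_add' x y := by
    refine Prod.ext (funext fun v => ?_) (funext fun e => ?_)
    · by_cases h : v = r
      · simp [h]
      · simp only [h, if_false, vertexBalance, Prod.fst_add, Prod.snd_add, Pi.add_apply]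
        rw [sub_add_sub_comm, ← Finset.sum_add_distrib, mul_add]
        congr 1
        refine Finset.sum_congr rfl fun e _ => ?_
        split_ifs <;> ring
    · simp only [Prod.fst_add, Prod.snd_add, Pi.add_apply]
      ring
  map_smul' c x := by
    refine Prod.ext (funext fun v => ?_) (funext fun e => ?_)
    · by_cases h : v = r
      · simp [h]
      · simp only [h, if_false, vertexBalance, Prod.smul_fst, Prod.smul_snd, Pi.smul_apply,
          smul_eq_mul, RingHom.id_apply]
        rw [mul_sub, Finset.mul_sum]
        congr 1
        · refine Finset.sum_congr rfl fun e _ => ?_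
          split_ifs <;> ring
        · ring
    · simp only [Prod.smul_fst, Prod.smul_snd, Pi.smul_apply, smul_eq_mul, RingHom.id_apply]
      ring

theorem continuous_vertexBalance (G : MetricGraph V E) (v : V) :
    Continuous fun x : ((E → ℝ) × (V → ℝ)) × ((V → ℝ) × (E → ℝ)) =>
      G.vertexBalance x.1.1 x.1.2 x.2.1 x.2.2 v := by
  unfold vertexBalance
  refine (continuous_finsetSum _ fun e _ => ?_).sub (by fun_prop)
  split_ifs <;> fun_prop

theorem continuous_rootedSystem (G : MetricGraph V E) (r : V) (x : (V → ℝ) × (E → ℝ)) :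
    Continuous fun τ => G.rootedSystem r τ x := by
  refine Continuous.prodMk (continuous_pi fun v => ?_) (continuous_pi fun e => by fun_prop)
  by_cases h : v = r
  · simp only [h, if_true]
    exact continuous_const
  · simp only [h, if_false]
    exact (G.continuous_vertexBalance v).comp (f := fun τ => (τ, x)) (by fun_prop)

/-- At `0` the edge equations make `u` constant, hence zero, and the vertex equations make `b`
divergence-free off the root. On a tree `b` is the gradient of a potential vanishing at the root;
pairing the two gives `∑ b² = 0`. -/
theorem IsTree.rootedSystem_zero_injective [Fintype V] {G : MetricGraph V E} (hG : G.IsTree)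
    (r : V) : Function.Injective (G.rootedSystem r 0) := by
  have hzero : ∀ u : V → ℝ, u r = 0 → (∀ e, u (G.term e) - u (G.init e) = 0) → u = 0 := by
    intro u hr hu
    refine funext (IsConnected.forall_vertex (G := G) hG.1.1 (P := fun v => u v = 0) ?_ ?_ hr)
    · intro e he; have := hu e; linarith
    · intro e he; have := hu e; linarith
  -- Value at the root together with the gradient: injective by connectedness, surjective because a
  -- tree has one vertex more than edges.
  let d : (V → ℝ) →ₗ[ℝ] ℝ × (E → ℝ) :=
    { toFun := fun u => (u r, fun e => u (G.term e) - u (G.init e))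
      map_add' := fun u w => Prod.ext rfl (funext fun e => by
        simp only [Pi.add_apply, Prod.mk_add_mk]; ring)
      map_smul' := fun c u => Prod.ext rfl (funext fun e => by
        simp only [Pi.smul_apply, smul_eq_mul, RingHom.id_apply, Prod.smul_mk]; ring) }
  have hd : Function.Surjective d := by
    refine (LinearMap.injective_iff_surjective_of_finrank_eq_finrank ?_).1 ?_
    · rw [Module.finrank_prod, Module.finrank_self, Module.finrank_fintype_fun_eq_card,
        Module.finrank_fintype_fun_eq_card, hG.card_vertices, add_comm]
    · refine (injective_iff_map_eq_zero d).2 fun u hu => ?_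
      exact hzero u (congrArg Prod.fst hu) fun e => congrFun (congrArg Prod.snd hu) e
  refine (injective_iff_map_eq_zero _).2 ?_
  rintro ⟨u, b⟩ hx
  have h1 : ∀ v, (if v = r then u r else G.vertexBalance 0 0 u b v) = 0 := fun v =>
    congrFun (congrArg Prod.fst hx) v
  have h2 : ∀ e, u (G.term e) - u (G.init e) = 0 := fun e => by
    have := congrFun (congrArg Prod.snd hx) e
    simpa [rootedSystem] using this
  have hu : u = 0 := hzero u (by simpa using h1 r) h2
  obtain ⟨h, hh⟩ := hd (0, b)
  have hhr : h r = 0 := congrArg Prod.fst hh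
  have hhb : ∀ e, h (G.term e) - h (G.init e) = b e := fun e => congrFun (congrArg Prod.snd hh) e
  have hsum : ∑ e, b e ^ 2 = 0 := by
    have h3 : ∑ v, ∑ e ∈ G.edgesAt v, h v * (if G.init e = v then -b e else b e) = 0 := by
      refine Finset.sum_eq_zero fun v _ => ?_
      rw [← Finset.mul_sum]
      by_cases hv : v = r
      · rw [hv, hhr, zero_mul]
      · have := h1 v
        rw [if_neg hv] at this
        simp only [vertexBalance, Pi.zero_apply, zero_mul, neg_zero, zero_add, sub_zero] at this
        rw [this, mul_zero]
    rw [G.sum_sum_edgesAt fun e v => h v * (if G.init e = v then -b e else b e)] at h3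
    rw [← h3]
    refine Finset.sum_congr rfl fun e _ => ?_
    rw [if_pos rfl, if_neg (G.init_ne_term e), ← hhb e]
    ring
  have hb : b = 0 := funext fun e => by
    have := (Finset.sum_eq_zero_iff_of_nonneg fun e _ => sq_nonneg (b e)).1 hsum e
      (Finset.mem_univ e)
    simpa using this
  rw [hu, hb]
  rfl

/-- For small half-angle tangents and coupling constants, the rooted system on a tree has a unique
normalized solution, which is continuous and close to `1` at the vertices. -/
theorem IsTree.exists_rooted_solution [Fintype V] {G : MetricGraph V E} (hG : G.IsTree) (r : V) :
    ∃ x : (E → ℝ) × (V → ℝ) → (V → ℝ) × (E → ℝ), ∀ᶠ τ in 𝓝 0, ContinuousAt x τ ∧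
      G.rootedSystem r τ (x τ) = (Pi.single r 1, 0) ∧ Function.Injective (G.rootedSystem r τ) ∧
      ∀ v, (x τ).1 v ∈ Set.Ioo (1 / 2) 2 := by
  have h0 := hG.rootedSystem_zero_injective r
  obtain ⟨x, hx⟩ := exists_continuousAt_solution (G.rootedSystem r) (G.continuous_rootedSystem r)
    h0 (Pi.single r 1, 0)
  refine ⟨x, ?_⟩
  have hx0 := hx.self_of_nhds
  have hone : x 0 = (1, 0) := by
    refine h0 (hx0.2.1.trans (Eq.symm ?_))
    refine Prod.ext (funext fun v => ?_) (funext fun e => ?_)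
    · by_cases hv : v = r
      · subst hv
        simp [rootedSystem]
      · simp [rootedSystem, hv, vertexBalance]
    · simp [rootedSystem]
  -- The lower bound makes the sum of two end values at least `1`; the upper bound controls the
  -- coupling terms.
  have hv : ∀ v, ∀ᶠ τ in 𝓝 0, (x τ).1 v ∈ Set.Ioo (1 / 2 : ℝ) 2 := fun v => by
    have hc : ContinuousAt (fun τ => (x τ).1 v) 0 :=
      (continuous_apply v).continuousAt.comp (continuous_fst.continuousAt.comp hx0.1)
    refine hc.eventually (Ioo_mem_nhds ?_ ?_)
    · change 1 / 2 < (x 0).1 v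
      rw [hone]
      norm_num
    · change (x 0).1 v < 2
      rw [hone]
      norm_num
  filter_upwards [hx, eventually_all.2 hv] with τ h1 h2
  exact ⟨h1.1, h1.2.1, h1.2.2, h2⟩

end

end MetricGraph

/-! ### Half-angle coordinates on an edge -/

/-- Values and derivatives of `A cos + B sin` at an angle `2φ`, in half-angle coordinates. -/
theorem Real.half_angle_coordinates {φ : ℝ} (hφ : Real.cos φ ≠ 0) (a b : ℝ) :
    (a - Real.tan φ * b) * Real.cos (2 * φ) + (Real.tan φ * a + b) * Real.sin (2 * φ)
      = a + Real.tan φ * b ∧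
    (Real.tan φ * a + b) * Real.cos (2 * φ) - (a - Real.tan φ * b) * Real.sin (2 * φ)
      = b - Real.tan φ * a := by
  have hs : Real.sin φ = Real.tan φ * Real.cos φ := (Real.tan_mul_cos hφ).symm
  have h1 := Real.sin_sq_add_cos_sq φ
  rw [Real.cos_two_mul', Real.sin_two_mul]
  rw [hs] at h1 ⊢
  constructor
  · linear_combination (a + Real.tan φ * b) * h1
  · linear_combination (b - Real.tan φ * a) * h1

/-- Every pair `A, B` has half-angle coordinates. -/
theorem Real.exists_half_angle_coordinates {φ : ℝ} (hφ : Real.cos φ ≠ 0) (A B : ℝ) :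
    ∃ a b, A = a - Real.tan φ * b ∧ B = Real.tan φ * a + b := by
  have hs : Real.sin φ = Real.tan φ * Real.cos φ := (Real.tan_mul_cos hφ).symm
  have h1 := Real.sin_sq_add_cos_sq φ
  rw [hs] at h1
  refine ⟨Real.cos φ ^ 2 * (A + Real.tan φ * B), Real.cos φ ^ 2 * (B - Real.tan φ * A), ?_, ?_⟩
  · linear_combination -A * h1
  · linear_combination -B * h1

/-- The phases of a frequency near a common near-period. -/
theorem Real.tan_half_near_period {x θ : ℝ} {m : ℤ} (h : x = θ + m * (2 * Real.pi)) :
    Real.tan (x / 2) = Real.tan (θ / 2) ∧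
      (Real.cos (θ / 2) ≠ 0 → Real.cos (x / 2) ≠ 0) := by
  have e : x / 2 = θ / 2 + m * Real.pi := by rw [h]; ring
  rw [e]
  refine ⟨Real.tan_periodic.int_mul m _, fun hc => ?_⟩
  rw [Real.cos_add_int_mul_pi]
  exact mul_ne_zero (zpow_ne_zero _ (by norm_num)) hc

namespace MetricGraph

section

variable {V E : Type*} [DecidableEq V]

/-- Here `a` is the mean of the two end values and `b` the mean of the two end derivatives divided
by `k`. Unlike the end values alone, these remain coordinates when `k * length e` lies in `2πℤ`. -/
theorem valueAt_mode_half_angle (G : MetricGraph V E) {k : ℝ} {a b : E → ℝ}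
    (hc : ∀ e, Real.cos (k * G.length e / 2) ≠ 0) (e : E) (v : V) :
    G.valueAt (G.mode k (fun e => a e - Real.tan (k * G.length e / 2) * b e)
      fun e => Real.tan (k * G.length e / 2) * a e + b e) e v =
      if G.init e = v then a e - Real.tan (k * G.length e / 2) * b e
      else a e + Real.tan (k * G.length e / 2) * b e := by
  have h := (Real.half_angle_coordinates (hc e) (a e) (b e)).1
  rw [mul_div_cancel₀ _ (two_ne_zero' ℝ)] at h
  rw [valueAt_mode, h]

theorem outwardDeriv_mode_half_angle (G : MetricGraph V E) {k : ℝ} {a b : E → ℝ}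
    (hc : ∀ e, Real.cos (k * G.length e / 2) ≠ 0) (e : E) (v : V) :
    G.outwardDeriv (G.mode k (k • fun e => Real.tan (k * G.length e / 2) * a e + b e)
      (-(k • fun e => a e - Real.tan (k * G.length e / 2) * b e))) e v =
      k * (-(Real.tan (k * G.length e / 2) * a e) + if G.init e = v then -b e else b e) := by
  have h := (Real.half_angle_coordinates (hc e) (a e) (b e)).2
  rw [mul_div_cancel₀ _ (two_ne_zero' ℝ)] at h
  rw [outwardDeriv_mode, h]
  split_ifs <;> ring

variable [Fintype E]

/-- Without Dirichlet vertices, the eigenfunctions for the eigenvalue `k ^ 2` are parametrized by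
the solutions of the balance equations. -/
theorem eigenspace_iff_balance (G : MetricGraph V E) {bc : V → VertexCondition}
    (hbc : ∀ v, bc v ≠ .dirichlet) {k : ℝ} (hk : 0 < k)
    (hc : ∀ e, Real.cos (k * G.length e / 2) ≠ 0) (ψ : G.EdgeFun) :
    ψ ∈ G.eigenspace bc (k ^ 2) ↔ ∃ (u : V → ℝ) (b : E → ℝ),
      (ψ = G.mode k
        (fun e => (u (G.init e) + u (G.term e)) / 2 - Real.tan (k * G.length e / 2) * b e)
        fun e => Real.tan (k * G.length e / 2) * ((u (G.init e) + u (G.term e)) / 2) + b e) ∧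
      (∀ e, u (G.term e) - u (G.init e) = 2 * Real.tan (k * G.length e / 2) * b e) ∧
      ∀ v, G.vertexBalance (fun e => Real.tan (k * G.length e / 2)) (fun v => coupling (bc v) / k)
        u b v = 0 := by
  have hbal : ∀ (u : V → ℝ) (b : E → ℝ) v,
      G.vertexBalance (fun e => Real.tan (k * G.length e / 2)) (fun v => coupling (bc v) / k) u b v
        = 0 ↔ ∑ e ∈ G.edgesAt v, k * (-(Real.tan (k * G.length e / 2) *
          ((u (G.init e) + u (G.term e)) / 2)) + if G.init e = v then -b e else b e) =
          coupling (bc v) * u v := by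
    intro u b v
    rw [vertexBalance, ← Finset.mul_sum, sub_eq_zero, div_mul_eq_mul_div, eq_div_iff hk.ne',
      mul_comm k]
  constructor
  · intro hψ
    obtain ⟨A, B, rfl, hS⟩ := G.exists_eq_mode bc hk hψ
    choose a b hA hB using fun e => Real.exists_half_angle_coordinates (hc e) (A e) (B e)
    obtain rfl : A = _ := funext hA
    obtain rfl : B = _ := funext hB
    choose u hu hs using fun v => (G.satisfies_iff _ _ v (hbc v)).1 (hS v)
    have hi : ∀ e, u (G.init e) = a e - Real.tan (k * G.length e / 2) * b e := fun e => by
      rw [← hu _ e (G.mem_edgesAt.2 (.inl rfl)), G.valueAt_mode_half_angle hc, if_pos rfl]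
    have ht : ∀ e, u (G.term e) = a e + Real.tan (k * G.length e / 2) * b e := fun e => by
      rw [← hu _ e (G.mem_edgesAt.2 (.inr rfl)), G.valueAt_mode_half_angle hc,
        if_neg (G.init_ne_term e)]
    have ha : ∀ e, a e = (u (G.init e) + u (G.term e)) / 2 := fun e => by rw [hi, ht]; ring
    refine ⟨u, b, ?_, fun e => by rw [hi, ht]; ring, fun v => (hbal u b v).2 ?_⟩
    · simp only [ha]
    · rw [← hs v]
      refine Finset.sum_congr rfl fun e _ => ?_
      rw [G.outwardDeriv_mode_half_angle hc, ha]
  · rintro ⟨u, b, rfl, hd, hb⟩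
    refine G.mode_mem_eigenspace bc k _ _ fun v => (G.satisfies_iff _ _ v (hbc v)).2
      ⟨u v, fun e he => ?_, ?_⟩
    · rw [G.valueAt_mode_half_angle hc]
      have := hd e
      split_ifs with h
      · rw [← h]; linarith
      · obtain rfl : G.term e = v := (G.mem_edgesAt.1 he).resolve_left h
        linarith
    · rw [← (hbal u b v).1 (hb v)]
      exact Finset.sum_congr rfl fun e _ => G.outwardDeriv_mode_half_angle hc e v

/-! ### Simple eigenvalues on trees -/

/-- On a tree, the balance equations have solutions without zeros for arbitrarily large `k`. -/
theorem IsTree.exists_balanced_solution [Fintype V] {G : MetricGraph V E} (hG : G.IsTree)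
    [Nonempty E] (α : V → ℝ) (r : V) (K : ℝ) : ∃ k, K < k ∧ 0 < k ∧
      (∀ e, Real.cos (k * G.length e / 2) ≠ 0) ∧
      Function.Injective (G.rootedSystem r
        (fun e => Real.tan (k * G.length e / 2), fun v => α v / k)) ∧
      ∃ (u : V → ℝ) (b : E → ℝ), (∀ v, u v ≠ 0) ∧
        (∀ e, u (G.term e) - u (G.init e) = 2 * Real.tan (k * G.length e / 2) * b e) ∧
        ∀ v, G.vertexBalance (fun e => Real.tan (k * G.length e / 2)) (fun v => α v / k) u b v
          = 0 := by
  obtain ⟨x, hx⟩ := hG.exists_rooted_solution r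
  obtain ⟨η, hη, hηx⟩ := Metric.eventually_nhds_iff.1 hx
  have htan0 : ∀ᶠ y in 𝓝 (0 : ℝ), |Real.tan y| < η := by
    have : ContinuousAt (fun y => |Real.tan y|) 0 :=
      (Real.continuousAt_tan.2 (by simp)).abs
    exact this.eventually_lt_const (by simpa using hη)
  obtain ⟨ρ', hρ', htan'⟩ := Metric.eventually_nhds_iff.1 htan0
  -- `ρ` bounds the half-phases: their tangents stay in the range of the perturbation lemma and, as
  -- `ρ ≤ 1 < π / 2`, their cosines do not vanish.
  obtain ⟨ρ, hρ, hρ1, htan⟩ : ∃ ρ : ℝ, 0 < ρ ∧ ρ ≤ 1 ∧ ∀ y, |y| ≤ ρ → |Real.tan y| < η :=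
    ⟨min (ρ' / 2) 1, by positivity, min_le_right _ _, fun y hy => htan' (by
      rw [Real.dist_0_eq_abs]
      linarith [min_le_left (ρ' / 2) 1])⟩
  obtain ⟨e₁, he₁⟩ := Finite.exists_max G.length
  obtain ⟨e₂, he₂⟩ := Finite.exists_min G.length
  set M := G.length e₁
  set m := G.length e₂
  have hM : 0 < M := G.length_pos e₁
  have hm : 0 < m := G.length_pos e₂
  -- Moving `k` by `c` shifts every phase by at least `c * m` and at most `ρ`. At `s ± c` the
  -- phases, with error at most `c * m / 2`, exceed `c * m / 2` in size, so the half-angle tangents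
  -- are at least `t₀ = c * m / 4` in size.
  set c := ρ / M with hc
  have hcpos : 0 < c := by positivity
  have hcM : c * M = ρ := by rw [hc]; field_simp
  set t₀ := c * m / 4 with ht₀
  have ht₀pos : 0 < t₀ := by positivity
  set S := ∑ v, |α v| with hS
  have hS0 : 0 ≤ S := Finset.sum_nonneg fun v _ => abs_nonneg _
  -- In the lower bound for `s`, `S / η` makes each `α v / k` smaller than `η`, `2 * S / t₀` makes
  -- the coupling sum at most `t₀`, and `c` accounts for the left end of the interval.
  obtain ⟨s, hs, hsm⟩ := exists_phases_near_zero G.length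
    (δ := min ρ (c * m / 2)) (by positivity) (|K| + 1 + S / η + 2 * S / t₀ + c)
  choose n hn using hsm
  set I := Set.Icc (s - c) (s + c) with hI
  have hkK : ∀ k ∈ I, |K| + 1 + S / η + 2 * S / t₀ ≤ k := fun k hk => by linarith [hk.1]
  have hSη : 0 ≤ S / η := by positivity
  have hSt : 0 ≤ 2 * S / t₀ := by positivity
  have hk0 : ∀ k ∈ I, 0 < k := fun k hk => by
    linarith [hkK k hk, abs_nonneg K]
  -- Reduced phases, with the same integers `n e` on the whole interval, so that they are affine in
  -- `k`.
  let θ : ℝ → E → ℝ := fun k e => k * G.length e - n e * (2 * Real.pi)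
  have hθ : ∀ k e, k * G.length e = θ k e + n e * (2 * Real.pi) := fun k e => by simp [θ]
  have hθs : ∀ k e, θ k e = (k - s) * G.length e + θ s e := fun k e => by simp only [θ]; ring
  have hθsmall : ∀ k ∈ I, ∀ e, |θ k e / 2| ≤ ρ := by
    intro k hk e
    have h1 : |(k - s) * G.length e| ≤ ρ := by
      rw [abs_mul, abs_of_pos (G.length_pos e), ← hcM]
      exact mul_le_mul (abs_le.2 ⟨by linarith [hk.1], by linarith [hk.2]⟩) (he₁ e)
        (G.length_pos e).le hcpos.le
    have h2 : |θ s e| < ρ := (hn e).trans_le (min_le_left _ _)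
    have h3 := abs_add_le ((k - s) * G.length e) (θ s e)
    rw [abs_div, hθs, abs_two]
    linarith
  have htanθ : ∀ k e, Real.tan (k * G.length e / 2) = Real.tan (θ k e / 2) := fun k e =>
    (Real.tan_half_near_period (hθ k e)).1
  have hcos : ∀ k ∈ I, ∀ e, Real.cos (k * G.length e / 2) ≠ 0 := fun k hk e =>
    (Real.tan_half_near_period (hθ k e)).2 (Real.cos_pos_of_mem_Ioo (by
      have := abs_le.1 (hθsmall k hk e)
      have := Real.pi_gt_three
      constructor <;> linarith)).ne'
  let τ : ℝ → (E → ℝ) × (V → ℝ) := fun k =>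
    (fun e => Real.tan (k * G.length e / 2), fun v => α v / k)
  have hτ : ∀ k ∈ I, dist (τ k) 0 < η := by
    intro k hk
    rw [dist_zero_right, Prod.norm_def]
    refine max_lt ((pi_norm_lt_iff hη).2 fun e => ?_) ((pi_norm_lt_iff hη).2 fun v => ?_)
    · change |Real.tan (k * G.length e / 2)| < η
      rw [htanθ]
      exact htan _ (hθsmall k hk e)
    · change |α v / k| < η
      rw [abs_div, abs_of_pos (hk0 k hk), div_lt_iff₀ (hk0 k hk)]
      have h1 : |α v| ≤ S := Finset.single_le_sum (f := fun v => |α v|)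
        (fun v _ => abs_nonneg _) (Finset.mem_univ v)
      have h2 : 1 + S / η ≤ k := by linarith [hkK k hk, abs_nonneg K]
      have h3 := mul_le_mul_of_nonneg_left h2 hη.le
      have h4 : η * (1 + S / η) = η + S := by field_simp
      linarith
  have hτc : ∀ k ∈ I, ContinuousAt τ k := by
    intro k hk
    refine ContinuousAt.prodMk (continuousAt_pi.2 fun e => ?_) (continuousAt_pi.2 fun v => ?_)
    · exact ContinuousAt.comp (f := fun k => k * G.length e / 2)
        (Real.continuousAt_tan.2 (hcos k hk e)) (by fun_prop)
    · exact continuousAt_const.div continuousAt_id (hk0 k hk).ne'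
  let F : ℝ → ℝ := fun k =>
    G.vertexBalance (τ k).1 (τ k).2 (x (τ k)).1 (x (τ k)).2 r
  have hF : ContinuousOn F I := fun k hk => by
    refine ContinuousAt.continuousWithinAt ?_
    have h1 : ContinuousAt (x ∘ τ) k := ContinuousAt.comp (hηx (hτ k hk)).1 (hτc k hk)
    have h2 : ContinuousAt (fun k => (τ k, (x ∘ τ) k)) k := (hτc k hk).prodMk h1
    exact ContinuousAt.comp (f := fun k => (τ k, (x ∘ τ) k))
      (g := fun y : ((E → ℝ) × (V → ℝ)) × ((V → ℝ) × (E → ℝ)) =>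
        G.vertexBalance y.1.1 y.1.2 y.2.1 y.2.2 r)
      (G.continuous_vertexBalance r).continuousAt h2
  have hbal : ∀ k ∈ I, ∀ v ≠ r,
      G.vertexBalance (τ k).1 (τ k).2 (x (τ k)).1 (x (τ k)).2 v = 0 := by
    intro k hk v hv
    have h1 := congrFun (congrArg Prod.fst (hηx (hτ k hk)).2.1) v
    change (if v = r then (x (τ k)).1 r else G.vertexBalance _ _ _ _ v) =
      (Pi.single r 1 : V → ℝ) v at h1
    rwa [if_neg hv, Pi.single_eq_of_ne hv] at h1
  -- All balances except the one at the root vanish, so the root balance is the total.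
  have hFsum : ∀ k ∈ I, F k = -∑ e, (τ k).1 e * ((x (τ k)).1 (G.init e) + (x (τ k)).1 (G.term e))
      - ∑ v, (τ k).2 v * (x (τ k)).1 v := by
    intro k hk
    rw [← sum_vertexBalance]
    exact (Finset.sum_eq_single r (fun v _ hv => hbal k hk v hv)
      fun h => absurd (Finset.mem_univ r) h).symm
  have hεsum : ∀ k ∈ I, |∑ v, (τ k).2 v * (x (τ k)).1 v| ≤ t₀ := by
    intro k hk
    have h1 : |∑ v, (τ k).2 v * (x (τ k)).1 v| ≤ ∑ v, |α v| * (2 / k) := by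
      refine (Finset.abs_sum_le_sum_abs _ _).trans (Finset.sum_le_sum fun v _ => ?_)
      have h2 := (hηx (hτ k hk)).2.2.2 v
      change |α v / k * _| ≤ _
      rw [abs_mul, abs_div, abs_of_pos (hk0 k hk), abs_of_pos (a := (x (τ k)).1 v) (by linarith [h2.1]),
        div_mul_eq_mul_div, ← mul_div_assoc]
      have := hk0 k hk
      gcongr
      exact h2.2.le
    refine h1.trans ?_
    rw [← Finset.sum_mul, ← hS, ← mul_div_assoc, div_le_iff₀ (hk0 k hk)]
    have h2 : 1 + 2 * S / t₀ ≤ k := by linarith [hkK k hk, abs_nonneg K]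
    have h3 := mul_le_mul_of_nonneg_left h2 ht₀pos.le
    have h4 : t₀ * (1 + 2 * S / t₀) = t₀ + 2 * S := by field_simp
    linarith
  -- `σ = ±1` is the common sign of the tangents. The terms do not cancel, and a single edge already
  -- contributes `t₀`, enough against the coupling sum.
  have htsum : ∀ k ∈ I, ∀ σ : ℝ, (∀ e, t₀ ≤ σ * (τ k).1 e) →
      t₀ ≤ σ * ∑ e, (τ k).1 e * ((x (τ k)).1 (G.init e) + (x (τ k)).1 (G.term e)) := by
    intro k hk σ hσ
    have hu := (hηx (hτ k hk)).2.2.2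
    have h1 : ∀ e, t₀ ≤ σ * ((τ k).1 e * ((x (τ k)).1 (G.init e) + (x (τ k)).1 (G.term e))) := by
      intro e
      rw [← mul_assoc]
      exact (hσ e).trans (le_mul_of_one_le_right (ht₀pos.le.trans (hσ e))
        (by linarith [(hu (G.init e)).1, (hu (G.term e)).1]))
    rw [Finset.mul_sum]
    refine (h1 e₁).trans (Finset.single_le_sum
      (f := fun e => σ * ((τ k).1 e * ((x (τ k)).1 (G.init e) + (x (τ k)).1 (G.term e))))
      (fun e _ => ht₀pos.le.trans (h1 e)) (Finset.mem_univ e₁))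
  have htanlow : ∀ y, t₀ ≤ y → y ≤ ρ → t₀ ≤ Real.tan y := fun y h1 h2 =>
    h1.trans (Real.le_tan (ht₀pos.le.trans h1) (by have := Real.pi_gt_three; linarith))
  have hcm : ∀ e, c * m ≤ c * G.length e := fun e => mul_le_mul_of_nonneg_left (he₂ e) hcpos.le
  have hδ : ∀ e, |θ s e| ≤ c * m / 2 := fun e => (hn e).le.trans (min_le_right _ _)
  have hright : s + c ∈ I := ⟨by linarith, le_rfl⟩
  have hleft : s - c ∈ I := ⟨le_rfl, by linarith⟩
  have hFr : F (s + c) ≤ 0 := by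
    have h1 := htsum _ hright 1 fun e => by
      change _ ≤ 1 * Real.tan _
      rw [one_mul, htanθ]
      refine htanlow _ ?_ (abs_le.1 (hθsmall _ hright e)).2
      rw [hθs, ht₀]
      linarith [hcm e, (abs_le.1 (hδ e)).1]
    rw [hFsum _ hright]
    linarith [(abs_le.1 (hεsum _ hright)).1]
  have hFl : 0 ≤ F (s - c) := by
    have h1 := htsum _ hleft (-1) fun e => by
      change _ ≤ -1 * Real.tan _
      rw [neg_one_mul, htanθ, ← Real.tan_neg]
      refine htanlow _ ?_ (by linarith [(abs_le.1 (hθsmall _ hleft e)).1])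
      rw [hθs, ht₀]
      linarith [hcm e, (abs_le.1 (hδ e)).2]
    rw [hFsum _ hleft]
    linarith [(abs_le.1 (hεsum _ hleft)).2]
  obtain ⟨k, hk, hFk⟩ := intermediate_value_Icc' (by linarith) hF ⟨hFr, hFl⟩
  have hsol := hηx (hτ k hk)
  refine ⟨k, by linarith [hkK k hk, le_abs_self K], hk0 k hk, hcos k hk, hsol.2.2.1,
    (x (τ k)).1, (x (τ k)).2, fun v => by linarith [(hsol.2.2.2 v).1] |> ne_of_gt, fun e => ?_,
    fun v => ?_⟩
  · have h1 := congrFun (congrArg Prod.snd hsol.2.1) e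
    exact sub_eq_zero.1 h1
  · by_cases hv : v = r
    · rw [hv]
      exact hFk
    · exact hbal k hk v hv

/-- A tree without Dirichlet vertices has arbitrarily large simple eigenvalues whose eigenfunctions
do not vanish at any vertex. -/
theorem IsTree.exists_simple_eigenvalue [Fintype V] {G : MetricGraph V E} (hG : G.IsTree)
    [Nonempty E] {bc : V → VertexCondition} (hbc : ∀ v, bc v ≠ .dirichlet) (K : ℝ) :
    ∃ lam, K < lam ∧ ∃ ψ : G.EdgeFun, G.IsEigenfunction bc lam ψ ∧
      G.multiplicity bc lam = 1 ∧ ∀ v, G.NonzeroAt ψ v := by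
  obtain ⟨e₀⟩ := ‹Nonempty E›
  obtain ⟨k, hkK, hk, hc, hinj, u, b, hu, hd, hb⟩ := IsTree.exists_balanced_solution
    -- The bound `max K 1` ensures `k > 1`, hence `k ^ 2 > k > K`.
    (G := G) hG (fun v => coupling (bc v)) (G.init e₀) (max K 1)
  have hk1 : 1 < k := (le_max_right _ _).trans_lt hkK
  refine ⟨k ^ 2, ?_, G.mode k
    (fun e => (u (G.init e) + u (G.term e)) / 2 - Real.tan (k * G.length e / 2) * b e)
    fun e => Real.tan (k * G.length e / 2) * ((u (G.init e) + u (G.term e)) / 2) + b e, ?_⟩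
  · have := (le_max_left K 1).trans_lt hkK
    nlinarith
  set ψ := G.mode k
    (fun e => (u (G.init e) + u (G.term e)) / 2 - Real.tan (k * G.length e / 2) * b e)
    fun e => Real.tan (k * G.length e / 2) * ((u (G.init e) + u (G.term e)) / 2) + b e with hψ
  have hmem : ψ ∈ G.eigenspace bc (k ^ 2) :=
    (G.eigenspace_iff_balance hbc hk hc ψ).2 ⟨u, b, rfl, hd, hb⟩
  have hval : ∀ (u : V → ℝ) (b : E → ℝ),
      (∀ e, u (G.term e) - u (G.init e) = 2 * Real.tan (k * G.length e / 2) * b e) →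
      ∀ v, ∀ e ∈ G.edgesAt v, G.valueAt (G.mode k
      (fun e => (u (G.init e) + u (G.term e)) / 2 - Real.tan (k * G.length e / 2) * b e)
      fun e => Real.tan (k * G.length e / 2) * ((u (G.init e) + u (G.term e)) / 2) + b e) e v
        = u v := by
    intro u b hd v e he
    rw [G.valueAt_mode_half_angle hc]
    have := hd e
    split_ifs with h
    · rw [← h]; linarith
    · obtain rfl : G.term e = v := (G.mem_edgesAt.1 he).resolve_left h
      linarith
  have he₀ : e₀ ∈ G.edgesAt (G.init e₀) := G.mem_edgesAt.2 (.inl rfl)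
  have hnz : ∀ v, G.NonzeroAt ψ v := fun v e he => by
    rw [hψ, hval u b hd v e he]
    exact hu v
  have hne : ψ ≠ 0 := fun h => by
    refine hnz _ e₀ he₀ ?_
    rw [h, ← zero_smul ℝ (0 : G.EdgeFun), valueAt_smul, zero_mul]
  -- An eigenfunction vanishing at the root solves the homogeneous rooted system. Thus evaluation at
  -- the root is injective on the eigenspace.
  have hzero : ∀ χ ∈ G.eigenspace bc (k ^ 2), G.valueAt χ e₀ (G.init e₀) = 0 → χ = 0 := by
    intro χ hχ h0
    obtain ⟨w, d, rfl, hd', hb'⟩ := (G.eigenspace_iff_balance hbc hk hc χ).1 hχ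
    rw [hval w d hd' _ e₀ he₀] at h0
    have hz : ((w, d) : (V → ℝ) × (E → ℝ)) = 0 := by
      refine hinj (Eq.trans ?_ (map_zero _).symm)
      refine Prod.ext (funext fun v => ?_) (funext fun e => sub_eq_zero.2 (hd' e))
      change (if v = G.init e₀ then w (G.init e₀) else G.vertexBalance _ _ w d v) = 0
      rw [h0, hb' v, ite_self]
    obtain rfl : w = 0 := congrArg Prod.fst hz
    obtain rfl : d = 0 := congrArg Prod.snd hz
    funext e
    ext x
    simp [mode]
  refine ⟨⟨hmem, hne⟩, ?_, hnz⟩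
  refine (finrank_eq_one_iff_of_nonzero' (⟨ψ, hmem⟩ : G.eigenspace bc (k ^ 2))
    fun h => hne (congrArg Subtype.val h)).2 ?_
  rintro ⟨χ, hχ⟩
  set c := G.valueAt χ e₀ (G.init e₀) / G.valueAt ψ e₀ (G.init e₀)
  refine ⟨c, Subtype.ext ?_⟩
  have h1 := hzero (c • ψ + (-1 : ℝ) • χ)
    (add_mem (Submodule.smul_mem _ _ hmem) (Submodule.smul_mem _ _ hχ)) (by
      rw [valueAt_add, valueAt_smul, valueAt_smul,
        div_mul_cancel₀ _ (hnz _ e₀ he₀)]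
      ring)
  rw [neg_one_smul, ← sub_eq_add_neg, sub_eq_zero] at h1
  exact h1

end

end MetricGraph

/-! ### The vertex quadratic form and its positive null vectors -/

namespace MetricGraph

section

variable {V E : Type*}

/-- The coefficients of the vertex form for edge phases `θ` and coupling constants `ε`. -/
noncomputable def phaseCoeffs (y : (E → ℝ) × (V → ℝ)) : (E → ℝ) × (E → ℝ) × (V → ℝ) :=
  (fun e => Real.cos (y.1 e) / Real.sin (y.1 e), fun e => (Real.sin (y.1 e))⁻¹, y.2)

theorem continuousAt_phaseCoeffs {y : (E → ℝ) × (V → ℝ)} (hy : ∀ e, Real.sin (y.1 e) ≠ 0) :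
    ContinuousAt phaseCoeffs y := by
  have hc : ∀ e, ContinuousAt (fun y : (E → ℝ) × (V → ℝ) => y.1 e) y := fun e =>
    ((continuous_apply e).comp continuous_fst).continuousAt
  refine ContinuousAt.prodMk (continuousAt_pi.2 fun e => ?_) (ContinuousAt.prodMk
    (continuousAt_pi.2 fun e => ?_) continuousAt_snd)
  · exact (Real.continuous_cos.continuousAt.comp (hc e)).div
      (Real.continuous_sin.continuousAt.comp (hc e)) (hy e)
  · exact (Real.continuous_sin.continuousAt.comp (hc e)).inv₀ (hy e)

section

variable [Fintype E] [DecidableEq V]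

/-- Half the derivative of the vertex form at `u` in the direction of the vertex `v`. -/
noncomputable def vertexFlux (G : MetricGraph V E) (x : (E → ℝ) × (E → ℝ) × (V → ℝ))
    (u : V → ℝ) (v : V) : ℝ :=
  ∑ e ∈ G.edgesAt v, (if G.init e = v then x.1 e * u (G.init e) - x.2.1 e * u (G.term e)
    else x.1 e * u (G.term e) - x.2.1 e * u (G.init e)) - x.2.2 v * u v

/-- A nonnegative function in the kernel of the vertex form is positive off `D`, when the vertices
in `D` have degree at most one. -/
theorem IsConnected.pos_of_vertexFlux_eq_zero {G : MetricGraph V E} (hG : G.IsConnected)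
    {D : Set V} (hD : ∀ v ∈ D, ∀ e ∈ G.edgesAt v, ∀ f ∈ G.edgesAt v, e = f)
    {x : (E → ℝ) × (E → ℝ) × (V → ℝ)} (hq : ∀ e, 0 < x.2.1 e) {u : V → ℝ} (hne : u ≠ 0)
    (h0 : ∀ v, 0 ≤ u v) (hf : ∀ v ∉ D, G.vertexFlux x u v = 0) :
    ∀ v ∉ D, 0 < u v := by
  intro r hr
  refine (h0 r).lt_of_ne fun hr0 => hne ?_
  -- At a zero of `u` off `D`, minus the flux is a sum of nonnegative terms `q * u` over the
  -- neighbours, so all of them vanish.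
  have hloc : ∀ v ∉ D, u v = 0 → ∀ e ∈ G.edgesAt v, u (G.init e) = 0 ∧ u (G.term e) = 0 := by
    intro v hv huv e he
    have h1 := hf v hv
    rw [vertexFlux, huv, mul_zero, sub_zero, ← neg_eq_zero, ← Finset.sum_neg_distrib,
      Finset.sum_eq_zero_iff_of_nonneg] at h1
    · have h2 := h1 e he
      by_cases h : G.init e = v
      · rw [if_pos h, h, huv] at h2
        rw [h]
        have := hq e
        simp only [mul_zero, zero_sub, neg_neg, mul_eq_zero] at h2
        exact ⟨huv, h2.resolve_left this.ne'⟩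
      · have h' : G.term e = v := (G.mem_edgesAt.1 he).resolve_left h
        rw [if_neg h, h', huv] at h2
        rw [h']
        have := hq e
        simp only [mul_zero, zero_sub, neg_neg, mul_eq_zero] at h2
        exact ⟨h2.resolve_left this.ne', huv⟩
    · intro f hf'
      by_cases h : G.init f = v
      · rw [if_pos h, h, huv]
        have := mul_nonneg (hq f).le (h0 (G.term f))
        linarith
      · have h' : G.term f = v := (G.mem_edgesAt.1 hf').resolve_left h
        rw [if_neg h, h', huv]
        have := mul_nonneg (hq f).le (h0 (G.init f))
        linarith
  -- A vertex of `D` satisfies no flux equation, but has no second edge to which vanishing would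
  -- have to spread.
  have hstep : ∀ v, ∀ e ∈ G.edgesAt v, u (G.init e) = 0 ∧ u (G.term e) = 0 →
      ∀ f ∈ G.edgesAt v, u (G.init f) = 0 ∧ u (G.term f) = 0 := by
    intro v e he hue f hf'
    by_cases hv : v ∈ D
    · rw [← hD v hv e he f hf']
      exact hue
    · refine hloc v hv ?_ f hf'
      obtain rfl | rfl := G.mem_edgesAt.1 he
      · exact hue.1
      · exact hue.2
  refine funext fun v => (hG.forall_vertex (r := r)
    (P := fun v => u v = 0 ∧ ∀ e ∈ G.edgesAt v, u (G.init e) = 0 ∧ u (G.term e) = 0)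
    (fun e he => ?_) (fun e he => ?_) ⟨hr0.symm, hloc r hr hr0.symm⟩ v).1
  · have h1 := he.2 e (G.mem_edgesAt.2 (.inl rfl))
    exact ⟨h1.2, hstep _ e (G.mem_edgesAt.2 (.inr rfl)) h1⟩
  · have h1 := he.2 e (G.mem_edgesAt.2 (.inr rfl))
    exact ⟨h1.1, hstep _ e (G.mem_edgesAt.2 (.inl rfl)) h1⟩

end

variable [Fintype V] [Fintype E]

/-- The quadratic form on vertex values with edge weights `p`, `q` and vertex weights `ε`. -/
noncomputable def vertexForm (G : MetricGraph V E) (x : (E → ℝ) × (E → ℝ) × (V → ℝ))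
    (u : V → ℝ) : ℝ :=
  ∑ e, (x.1 e * (u (G.init e) ^ 2 + u (G.term e) ^ 2) -
    2 * x.2.1 e * (u (G.init e) * u (G.term e))) - ∑ v, x.2.2 v * u v ^ 2

/-- The vertex form is positive definite on the functions that vanish on `D`. -/
def VertexFormPos (G : MetricGraph V E) (D : Set V) (x : (E → ℝ) × (E → ℝ) × (V → ℝ)) : Prop :=
  ∀ u : V → ℝ, (∀ v ∈ D, u v = 0) → u ≠ 0 → 0 < G.vertexForm x u

theorem continuous_vertexForm (G : MetricGraph V E) :
    Continuous fun y : ((E → ℝ) × (E → ℝ) × (V → ℝ)) × (V → ℝ) => G.vertexForm y.1 y.2 := by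
  unfold vertexForm
  fun_prop

theorem continuous_vertexForm_left (G : MetricGraph V E) (u : V → ℝ) :
    Continuous fun x : (E → ℝ) × (E → ℝ) × (V → ℝ) => G.vertexForm x u := by
  unfold vertexForm
  fun_prop

theorem vertexForm_smul_right (G : MetricGraph V E) (x : (E → ℝ) × (E → ℝ) × (V → ℝ)) (c : ℝ)
    (u : V → ℝ) : G.vertexForm x (c • u) = c ^ 2 * G.vertexForm x u := by
  simp only [vertexForm, mul_sub, Finset.mul_sum, Pi.smul_apply, smul_eq_mul]
  congr 1
  · exact Finset.sum_congr rfl fun e _ => by ring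
  · exact Finset.sum_congr rfl fun v _ => by ring

theorem vertexForm_smul_left (G : MetricGraph V E) (x : (E → ℝ) × (E → ℝ) × (V → ℝ)) (c : ℝ)
    (u : V → ℝ) : G.vertexForm (c • x) u = c * G.vertexForm x u := by
  simp only [vertexForm, mul_sub, Finset.mul_sum, Prod.smul_fst, Prod.smul_snd, Pi.smul_apply,
    smul_eq_mul]
  congr 1
  · exact Finset.sum_congr rfl fun e _ => by ring
  · exact Finset.sum_congr rfl fun v _ => by ring

/-- By homogeneity it suffices to test on the unit sphere of the subspace, which is compact. -/
theorem VertexFormPos.eventually {G : MetricGraph V E} {D : Set V}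
    {x : (E → ℝ) × (E → ℝ) × (V → ℝ)} (hx : G.VertexFormPos D x) :
    ∀ᶠ y in 𝓝 x, G.VertexFormPos D y := by
  have hW : IsClosed {u : V → ℝ | ∀ v ∈ D, u v = 0} := by
    simp only [Set.ofPred_forall]
    exact isClosed_iInter fun v => isClosed_iInter fun _ =>
      isClosed_eq (continuous_apply v) continuous_const
  have hK : IsCompact (Metric.sphere (0 : V → ℝ) 1 ∩ {u : V → ℝ | ∀ v ∈ D, u v = 0}) :=
    (isCompact_sphere _ _).inter_right hW
  have h := hK.eventually_forall_of_forall_eventually (x₀ := x)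
    (P := fun y u => 0 < G.vertexForm y u) fun u hu =>
      G.continuous_vertexForm.continuousAt.eventually_const_lt (hx u hu.2 fun h0 => by
        have := hu.1
        rw [h0] at this
        simp at this)
  filter_upwards [h] with y hy u hu hne
  have hn : 0 < ‖u‖ := norm_pos_iff.2 hne
  have h1 := hy (‖u‖⁻¹ • u) ⟨by simp [norm_smul, hn.ne'], fun v hv => by simp [hu v hv]⟩
  rw [vertexForm_smul_right] at h1
  exact (mul_pos_iff_of_pos_left (by positivity)).1 h1

/-- Only the products over edges change, and they enter with negative coefficients. -/
theorem vertexForm_abs_le (G : MetricGraph V E) {x : (E → ℝ) × (E → ℝ) × (V → ℝ)}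
    (hq : ∀ e, 0 < x.2.1 e) (u : V → ℝ) : G.vertexForm x (fun v => |u v|) ≤ G.vertexForm x u := by
  simp only [vertexForm, sq_abs]
  refine sub_le_sub_right (Finset.sum_le_sum fun e _ => sub_le_sub_left
    (mul_le_mul_of_nonneg_left ?_ (mul_pos two_pos (hq e)).le) _) _
  rw [← abs_mul]
  exact le_abs_self _

/-- For small frequencies, the vertex form is positive definite if `D` is nonempty. -/
theorem IsConnected.vertexFormPos_small {G : MetricGraph V E} (hG : G.IsConnected) {D : Set V}
    (hD : D.Nonempty) : ∀ᶠ κ in 𝓝[>] (0 : ℝ),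
      G.VertexFormPos D (phaseCoeffs (fun e => κ * G.length e, 0)) := by
  -- `κ` times the phase coefficients, written with `sinc` to extend continuously to `κ = 0`. The
  -- limit is the discrete Dirichlet energy with weights `1 / length e`, definite on functions
  -- vanishing somewhere.
  let Y : ℝ → (E → ℝ) × (E → ℝ) × (V → ℝ) := fun κ =>
    (fun e => Real.cos (κ * G.length e) / (G.length e * Real.sinc (κ * G.length e)),
      fun e => (G.length e * Real.sinc (κ * G.length e))⁻¹, 0)
  have hY : ContinuousAt Y 0 := by
    have hs : ∀ e, ContinuousAt (fun κ => G.length e * Real.sinc (κ * G.length e)) 0 := fun e =>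
      (continuous_const.mul (Real.continuous_sinc.comp
        (continuous_id.mul continuous_const))).continuousAt
    have hne : ∀ e, G.length e * Real.sinc (0 * G.length e) ≠ 0 := fun e => by
      simp [(G.length_pos e).ne']
    refine ContinuousAt.prodMk (continuousAt_pi.2 fun e => ?_) (ContinuousAt.prodMk
      (continuousAt_pi.2 fun e => ?_) continuousAt_const)
    · exact ContinuousAt.div (by fun_prop) (hs e) (hne e)
    · exact (hs e).inv₀ (hne e)
  have h0 : G.VertexFormPos D (Y 0) := by
    intro u hu hne
    have h1 : G.vertexForm (Y 0) u = ∑ e, (G.length e)⁻¹ * (u (G.init e) - u (G.term e)) ^ 2 := by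
      simp only [vertexForm, Y, Pi.zero_apply, zero_mul, Finset.sum_const_zero, sub_zero,
        Real.cos_zero, Real.sinc_zero, mul_one]
      exact Finset.sum_congr rfl fun e _ => by ring
    rw [h1]
    have hnn : ∀ e ∈ Finset.univ, 0 ≤ (G.length e)⁻¹ * (u (G.init e) - u (G.term e)) ^ 2 :=
      fun e _ => mul_nonneg (inv_nonneg.2 (G.length_pos e).le) (sq_nonneg _)
    refine (Finset.sum_nonneg hnn).lt_of_ne fun h => hne ?_
    have heq : ∀ e, u (G.init e) = u (G.term e) := fun e => by
      have h2 := (Finset.sum_eq_zero_iff_of_nonneg hnn).1 h.symm e (Finset.mem_univ e)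
      have h3 := (mul_eq_zero.1 h2).resolve_left (inv_ne_zero (G.length_pos e).ne')
      exact sub_eq_zero.1 (pow_eq_zero_iff (two_ne_zero)|>.1 h3)
    obtain ⟨r, hr⟩ := hD
    exact funext (hG.forall_vertex (P := fun v => u v = 0) (fun e he => (heq e).symm.trans he)
      (fun e he => (heq e).trans he) (hu r hr))
  filter_upwards [(hY.eventually h0.eventually).filter_mono nhdsWithin_le_nhds,
    self_mem_nhdsWithin] with κ hκ hκ0 u hu hne
  have hκ0' : (0 : ℝ) < κ := hκ0
  have h1 : Y κ = κ • phaseCoeffs (fun e => κ * G.length e, 0) := by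
    have hsinc : ∀ e, G.length e * Real.sinc (κ * G.length e) =
        Real.sin (κ * G.length e) / κ := fun e => by
      have := (G.length_pos e).ne'
      rw [Real.sinc_of_ne_zero (mul_ne_zero hκ0'.ne' this)]
      field_simp
    refine Prod.ext (funext fun e => ?_) (Prod.ext (funext fun e => ?_) ?_)
    · simp only [Y, phaseCoeffs, hsinc, Prod.smul_fst, Pi.smul_apply, smul_eq_mul]
      rw [div_div_eq_mul_div, mul_div_right_comm, mul_comm κ (_ / _)]
    · simp only [Y, phaseCoeffs, hsinc, Prod.smul_fst, Prod.smul_snd, Pi.smul_apply, smul_eq_mul,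
        inv_div]
      rfl
    · simp [Y, phaseCoeffs]
  have h2 := hκ u hu hne
  rw [h1, vertexForm_smul_left] at h2
  exact (mul_pos_iff_of_pos_left hκ0').1 h2

variable [DecidableEq V]

/-- Exact second-order expansion, with the flux as half the gradient. -/
theorem vertexForm_add (G : MetricGraph V E) (x : (E → ℝ) × (E → ℝ) × (V → ℝ)) (u h : V → ℝ) :
    G.vertexForm x (u + h) =
      G.vertexForm x u + 2 * ∑ v, h v * G.vertexFlux x u v + G.vertexForm x h := by
  have h1 : ∑ v, h v * G.vertexFlux x u v =
      ∑ e, (h (G.init e) * (x.1 e * u (G.init e) - x.2.1 e * u (G.term e)) +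
        h (G.term e) * (x.1 e * u (G.term e) - x.2.1 e * u (G.init e))) -
      ∑ v, x.2.2 v * u v * h v := by
    simp only [vertexFlux, mul_sub, Finset.mul_sum, Finset.sum_sub_distrib]
    rw [G.sum_sum_edgesAt fun e v => h v *
      (if G.init e = v then x.1 e * u (G.init e) - x.2.1 e * u (G.term e)
        else x.1 e * u (G.term e) - x.2.1 e * u (G.init e))]
    congr 1
    · refine Finset.sum_congr rfl fun e _ => ?_
      rw [if_pos rfl, if_neg (G.init_ne_term e)]
      ring
    · exact Finset.sum_congr rfl fun v _ => by ring
  rw [h1]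
  simp only [vertexForm, Pi.add_apply, mul_sub, Finset.mul_sum]
  have h2 : ∀ a b c d e f : ℝ, a - b + (c - d) + (e - f) = a + c + e - (b + d + f) := by
    intros; ring
  rw [h2, ← Finset.sum_add_distrib, ← Finset.sum_add_distrib, ← Finset.sum_add_distrib,
    ← Finset.sum_add_distrib]
  congr 1
  · exact Finset.sum_congr rfl fun e _ => by ring
  · exact Finset.sum_congr rfl fun v _ => by ring

/-- A zero of a positive semidefinite vertex form lies in its kernel. -/
theorem vertexFlux_eq_zero (G : MetricGraph V E) {D : Set V} {x : (E → ℝ) × (E → ℝ) × (V → ℝ)}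
    (hx : ∀ u : V → ℝ, (∀ v ∈ D, u v = 0) → 0 ≤ G.vertexForm x u) {u : V → ℝ}
    (hu : ∀ v ∈ D, u v = 0) (h0 : G.vertexForm x u = 0) {v : V} (hv : v ∉ D) :
    G.vertexFlux x u v = 0 := by
  have key : ∀ s : ℝ, 0 ≤ 2 * (s * G.vertexFlux x u v) +
      s ^ 2 * G.vertexForm x (Pi.single v 1) := by
    intro s
    have h1 := hx (u + s • Pi.single v 1) fun w hw => by
      have : w ≠ v := fun h => hv (h ▸ hw)
      simp [hu w hw, this]
    rw [vertexForm_add, h0, vertexForm_smul_right, zero_add] at h1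
    convert h1 using 3
    rw [Finset.sum_eq_single v (fun w _ hw => by simp [hw]) (by simp)]
    simp
  set f := G.vertexFlux x u v
  set C := G.vertexForm x (Pi.single v 1)
  by_contra hf
  have hC : 0 < |C| + 1 := by positivity
  -- A step against the gradient, short enough for the linear term to dominate the quadratic one.
  have h1 := key (-f / (|C| + 1))
  have h2 : 2 * (-f / (|C| + 1) * f) + (-f / (|C| + 1)) ^ 2 * C =
      f ^ 2 / (|C| + 1) ^ 2 * (C - 2 * (|C| + 1)) := by
    field_simp
    ring
  rw [h2] at h1
  have h3 : 0 < f ^ 2 / (|C| + 1) ^ 2 := by positivity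
  have h4 := nonneg_of_mul_nonneg_right h1 h3
  linarith [le_abs_self C, abs_nonneg C]

/-- If the vertex form loses positivity along an interval, at some parameter it has a kernel
element that is positive off `D`. -/
theorem IsConnected.exists_pos_kernel {G : MetricGraph V E} (hG : G.IsConnected)
    {D : Set V} (hD : ∀ v ∈ D, ∀ e ∈ G.edgesAt v, ∀ f ∈ G.edgesAt v, e = f) {a b : ℝ}
    (hab : a ≤ b) {X : ℝ → (E → ℝ) × (E → ℝ) × (V → ℝ)} (hX : ContinuousOn X (Set.Icc a b))
    (hq : ∀ k ∈ Set.Icc a b, ∀ e, 0 < (X k).2.1 e) (ha : G.VertexFormPos D (X a))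
    {w : V → ℝ} (hw : ∀ v ∈ D, w v = 0) (hb : G.vertexForm (X b) w < 0) :
    ∃ k ∈ Set.Icc a b, ∃ u : V → ℝ, (∀ v ∈ D, u v = 0) ∧ (∀ v ∉ D, 0 < u v) ∧
      ∀ v ∉ D, G.vertexFlux (X k) u v = 0 := by
  set T := {x | ∀ u : V → ℝ, (∀ v ∈ D, u v = 0) → 0 ≤ G.vertexForm x u} with hT
  have hTc : IsClosed T := by
    simp only [hT, Set.ofPred_forall]
    exact isClosed_iInter fun u => isClosed_iInter fun _ => isClosed_le continuous_const
      (G.continuous_vertexForm_left u)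
  have hpos : ∀ x, G.VertexFormPos D x → x ∈ T := by
    intro x hx u hu
    by_cases h : u = 0
    · rw [h]
      simp [vertexForm]
    · exact (hx u hu h).le
  have hS : IsCompact (Set.Icc a b ∩ X ⁻¹' T) :=
    isCompact_Icc.of_isClosed_subset (hX.preimage_isClosed_of_isClosed isClosed_Icc hTc)
      Set.inter_subset_left
  have hk := hS.sSup_mem ⟨a, ⟨Set.left_mem_Icc.2 hab, hpos _ ha⟩⟩
  -- The last parameter at which the form is semidefinite. It is not definite there, since
  -- definiteness would persist slightly to the right.
  set k := sSup (Set.Icc a b ∩ X ⁻¹' T)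
  have hkb : k < b := hk.1.2.lt_of_ne fun h => by
    have := hk.2 w hw
    rw [h] at this
    exact this.not_gt hb
  have hnot : ¬ G.VertexFormPos D (X k) := by
    intro hp
    have h1 : ∀ᶠ y in 𝓝[Set.Ioc k b] k, G.VertexFormPos D (X y) :=
      ((hX k hk.1).eventually hp.eventually).filter_mono (nhdsWithin_mono _ fun y hy =>
        Set.mem_Icc.2 ⟨hk.1.1.trans hy.1.le, hy.2⟩)
    have : (𝓝[Set.Ioc k b] k).NeBot := by
      rw [nhdsWithin_Ioc_eq_nhdsGT hkb]
      infer_instance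
    obtain ⟨y, hy, hyk⟩ := (h1.and self_mem_nhdsWithin).exists
    have hmem : y ∈ Set.Icc a b ∩ X ⁻¹' T := ⟨⟨hk.1.1.trans hyk.1.le, hyk.2⟩, hpos _ hy⟩
    exact (le_csSup hS.bddAbove hmem).not_gt hyk.1
  simp only [VertexFormPos, not_forall, not_lt] at hnot
  obtain ⟨u, hu, hne, hle⟩ := hnot
  have huD : ∀ v ∈ D, (fun v => |u v|) v = 0 := fun v hv => by simp [hu v hv]
  have hz : G.vertexForm (X k) (fun v => |u v|) = 0 :=
    le_antisymm ((G.vertexForm_abs_le (hq k hk.1) u).trans hle) (hk.2 _ huD)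
  have hflux : ∀ v ∉ D, G.vertexFlux (X k) (fun v => |u v|) v = 0 := fun v hv =>
    G.vertexFlux_eq_zero hk.2 huD hz hv
  refine ⟨k, hk.1, fun v => |u v|, huD, ?_, hflux⟩
  refine hG.pos_of_vertexFlux_eq_zero hD (hq k hk.1) (fun h => hne ?_) (fun v => abs_nonneg _)
    hflux
  funext v
  exact abs_eq_zero.1 (congrFun h v)

/-- Without loops, no edge has both ends at `v`, so the mixed products vanish. -/
theorem vertexForm_single (G : MetricGraph V E) (p q : E → ℝ) (v : V) :
    G.vertexForm (p, q, 0) (Pi.single v 1) = ∑ e ∈ G.edgesAt v, p e := by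
  simp only [vertexForm, edgesAt, Finset.sum_filter, Pi.zero_apply, zero_mul, Finset.sum_const_zero,
    sub_zero]
  refine Finset.sum_congr rfl fun e _ => ?_
  have := G.init_ne_term e
  by_cases h1 : G.init e = v
  · have h2 : G.term e ≠ v := fun h => this (h1.trans h.symm)
    simp [h1, h2]
  · by_cases h2 : G.term e = v
    · simp [h1, h2]
    · simp [h1, h2]

/-- Just below the first Dirichlet frequency of a longest edge, the vertex form is negative at the
indicator of an end of that edge. -/
theorem exists_vertexForm_neg (G : MetricGraph V E) {e₁ : E} (he₁ : ∀ e, G.length e ≤ G.length e₁)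
    {v : V} (hv : e₁ ∈ G.edgesAt v) : ∃ κ, Real.pi / 2 ≤ κ * G.length e₁ ∧
      κ * G.length e₁ < Real.pi ∧
      G.vertexForm (phaseCoeffs (fun e => κ * G.length e, 0)) (Pi.single v 1) < 0 := by
  have : Nonempty E := ⟨e₁⟩
  obtain ⟨e₂, he₂⟩ := Finite.exists_min G.length
  set M := G.length e₁
  set m := G.length e₂
  have hM : 0 < M := G.length_pos e₁
  have hm : 0 < m := G.length_pos e₂
  set C := M / m
  have hC : 0 < C := by positivity
  set N : ℝ := ((G.edgesAt v).card : ℝ)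
  have hN : 0 ≤ N := Nat.cast_nonneg _
  -- `y` is the distance of the longest edge's phase from `π`, so small that its cotangent, at most
  -- `-(N * C + 1)`, outweighs the other edges at `v`, whose cotangents are at most `C`.
  set y := (2 * (N * C + 1))⁻¹ with hy
  have hNC : 0 ≤ N * C := by positivity
  have hy0 : 0 < y := by positivity
  have hy1 : y ≤ 1 / 2 := by
    rw [hy, one_div]
    exact inv_anti₀ two_pos (by linarith)
  have hpi := Real.pi_gt_three
  set κ := (Real.pi - y) / M with hκ
  have hκM : κ * M = Real.pi - y := by rw [hκ]; field_simp
  have hκ0 : 0 < κ := by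
    have : 0 < Real.pi - y := by linarith
    positivity
  refine ⟨κ, by linarith, by linarith, ?_⟩
  have hbound : ∀ e, Real.cos (κ * G.length e) / Real.sin (κ * G.length e) ≤ C := by
    intro e
    have hle : κ * G.length e ≤ κ * M := mul_le_mul_of_nonneg_left (he₁ e) hκ0.le
    have hpos : 0 < κ * G.length e := mul_pos hκ0 (G.length_pos e)
    have hsin : 0 < Real.sin (κ * G.length e) := Real.sin_pos_of_pos_of_lt_pi hpos (by linarith)
    rw [div_le_iff₀ hsin]
    rcases le_or_gt (Real.pi / 2) (κ * G.length e) with h | h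
    · exact (Real.cos_nonpos_of_pi_div_two_le_of_le h (by linarith)).trans (by positivity)
    · refine (Real.cos_le_one _).trans ?_
      -- Jordan's inequality; the constant `C = M / m` compensates for the shortest edge because `κ
      -- * M ≥ π / 2`.
      have h1 := Real.mul_le_sin hpos.le h.le
      have h2 : κ * m ≤ κ * G.length e := mul_le_mul_of_nonneg_left (he₂ e) hκ0.le
      have h3 : 1 ≤ C * (2 / Real.pi * (κ * m)) := by
        have : C * (2 / Real.pi * (κ * m)) = 2 * (κ * M) / Real.pi := by
          simp only [C]
          field_simp
        rw [this, hκM, le_div_iff₀ Real.pi_pos]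
        linarith
      refine h3.trans (mul_le_mul_of_nonneg_left ?_ hC.le)
      refine le_trans ?_ h1
      gcongr
  have hlow : Real.cos (κ * M) / Real.sin (κ * M) ≤ -(N * C + 1) := by
    rw [hκM, Real.cos_pi_sub, Real.sin_pi_sub, neg_div, neg_le_neg_iff]
    have hs : 0 < Real.sin y := Real.sin_pos_of_pos_of_lt_pi hy0 (by linarith)
    rw [le_div_iff₀ hs]
    have h1 : (N * C + 1) * Real.sin y ≤ (N * C + 1) * y :=
      mul_le_mul_of_nonneg_left (Real.sin_le hy0.le) (by linarith)
    have h2 : (N * C + 1) * y = 1 / 2 := by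
      rw [hy]
      field_simp
    have h3 := Real.one_sub_sq_div_two_le_cos (x := y)
    nlinarith
  change G.vertexForm (fun e => Real.cos (κ * G.length e) / Real.sin (κ * G.length e), _, 0) _ < 0
  rw [vertexForm_single]
  have h1 := Finset.single_le_sum
    (f := fun e => C - Real.cos (κ * G.length e) / Real.sin (κ * G.length e))
    (fun e _ => sub_nonneg.2 (hbound e)) hv
  simp only [Finset.sum_sub_distrib, Finset.sum_const, nsmul_eq_mul] at h1
  change C - Real.cos (κ * M) / Real.sin (κ * M) ≤ N * C - _ at h1
  linarith

end

end MetricGraph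

/-! ### Eigenfunctions of full support -/

namespace MetricGraph

section

variable {V E : Type*} [Fintype E] [DecidableEq V]

/-- A solution of the flux equations off the Dirichlet vertices yields an eigenfunction with the
given vertex values. -/
theorem exists_mem_eigenspace_of_vertexFlux (G : MetricGraph V E) {bc : V → VertexCondition} {k : ℝ}
    (hk : 0 < k) (hs : ∀ e, Real.sin (k * G.length e) ≠ 0) {u : V → ℝ}
    (hu : ∀ v, bc v = .dirichlet → u v = 0)
    (hf : ∀ v, bc v ≠ .dirichlet → G.vertexFlux
      (phaseCoeffs (fun e => k * G.length e, fun v => coupling (bc v) / k)) u v = 0) :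
    ∃ ψ ∈ G.eigenspace bc (k ^ 2), ∀ v, ∀ e ∈ G.edgesAt v, G.valueAt ψ e v = u v := by
  -- The edge solution interpolating the vertex values, unique because the sine is nonzero.
  set A : E → ℝ := fun e => u (G.init e)
  set B : E → ℝ := fun e =>
    (u (G.term e) - u (G.init e) * Real.cos (k * G.length e)) / Real.sin (k * G.length e)
  have hval : ∀ v, ∀ e ∈ G.edgesAt v, G.valueAt (G.mode k A B) e v = u v := by
    intro v e he
    rw [valueAt_mode]
    split_ifs with h
    · exact congrArg u h
    · obtain rfl : G.term e = v := (G.mem_edgesAt.1 he).resolve_left h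
      simp only [A, B]
      rw [div_mul_cancel₀ _ (hs e)]
      ring
  refine ⟨G.mode k A B, G.mode_mem_eigenspace bc k A B fun v => ?_, hval⟩
  by_cases hv : bc v = .dirichlet
  · rw [hv]
    intro e he
    rw [hval v e he, hu v hv]
  · refine (G.satisfies_iff _ _ v hv).2 ⟨u v, hval v, ?_⟩
    have h1 := hf v hv
    rw [vertexFlux, sub_eq_zero] at h1
    have h2 : coupling (bc v) * u v = k * (coupling (bc v) / k * u v) := by
      field_simp
    rw [h2]
    refine Eq.trans ?_ (congrArg (k * ·) h1)
    rw [Finset.mul_sum]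
    refine Finset.sum_congr rfl fun e _ => ?_
    rw [outwardDeriv_mode]
    congr 1
    have hse := hs e
    have hcs := Real.sin_sq_add_cos_sq (k * G.length e)
    simp only [A, B, phaseCoeffs]
    split_ifs
    · field_simp
      ring
    · field_simp
      linear_combination -u (G.init e) * hcs

/-- An edge joining two vertices of degree one is the whole connected graph. -/
theorem IsConnected.eq_of_degree_one {G : MetricGraph V E} (hG : G.IsConnected) {D : Set V}
    (hD : ∀ v ∈ D, ∀ e ∈ G.edgesAt v, ∀ f ∈ G.edgesAt v, e = f) {e₀ : E}
    (hi : G.init e₀ ∈ D) (ht : G.term e₀ ∈ D) :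
    (∀ e, e = e₀) ∧ ∀ v, v = G.init e₀ ∨ v = G.term e₀ := by
  have hloc : ∀ v, (v = G.init e₀ ∨ v = G.term e₀) → ∀ e ∈ G.edgesAt v, e = e₀ := by
    rintro v (rfl | rfl) e he
    · exact hD _ hi e he e₀ (G.mem_edgesAt.2 (.inl rfl))
    · exact hD _ ht e he e₀ (G.mem_edgesAt.2 (.inr rfl))
  have hall : ∀ v, v = G.init e₀ ∨ v = G.term e₀ := by
    refine hG.forall_vertex (r := G.init e₀) (fun e he => ?_) (fun e he => ?_) (.inl rfl)
    · rw [hloc _ he e (G.mem_edgesAt.2 (.inl rfl))]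
      exact .inr rfl
    · rw [hloc _ he e (G.mem_edgesAt.2 (.inr rfl))]
      exact .inl rfl
  exact ⟨fun e => hloc _ (hall _) e (G.mem_edgesAt.2 (.inl rfl)), hall⟩

/-- An interval with Dirichlet conditions has arbitrarily large eigenvalues. -/
theorem exists_eigenfunction_interval (G : MetricGraph V E) {bc : V → VertexCondition} {e₀ : E}
    (hE : ∀ e, e = e₀) (hbc : ∀ v, bc v = .dirichlet) (K : ℝ) :
    ∃ lam, K < lam ∧ ∃ ψ : G.EdgeFun, G.IsEigenfunction bc lam ψ ∧ G.HasFullSupport ψ := by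
  have hℓ := G.length_pos e₀
  have hpi := Real.pi_pos
  obtain ⟨n, hn⟩ := exists_nat_gt ((max K 1) * G.length e₀ / Real.pi)
  rw [div_lt_iff₀ hpi] at hn
  set k := n * Real.pi / G.length e₀ with hkdef
  have hkK : max K 1 < k := by rwa [hkdef, lt_div_iff₀ hℓ]
  have hk1 : 1 < k := (le_max_right _ _).trans_lt hkK
  have hkℓ : k * G.length e₀ = n * Real.pi := by rw [hkdef]; field_simp
  have hfull : G.HasFullSupport (G.mode k 0 1) := by
    intro e
    obtain rfl := hE e
    have hn1 : (1 : ℝ) ≤ n := by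
      have : n ≠ 0 := fun h => by
        rw [h, Nat.cast_zero, zero_mul] at hkℓ
        have : 0 < k * G.length e := by positivity
        linarith
      exact_mod_cast Nat.one_le_iff_ne_zero.2 this
    -- The first point at which the sine equals `1`.
    refine ⟨⟨Real.pi / 2 / k, by positivity, ?_⟩, ?_⟩
    · rw [div_le_iff₀ (by positivity), mul_comm, hkℓ]
      nlinarith
    · have : k * (Real.pi / 2 / k) = Real.pi / 2 := by field_simp
      simp [mode, this]
  refine ⟨k ^ 2, ?_, G.mode k 0 1, ⟨G.mode_mem_eigenspace bc k 0 1 fun v => ?_, fun h => ?_⟩, hfull⟩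
  · have := (le_max_left K 1).trans_lt hkK
    nlinarith
  · rw [hbc v]
    intro e _
    rw [valueAt_mode, hE e, hkℓ]
    simp
  · obtain ⟨x, hx⟩ := hfull e₀
    rw [h] at hx
    exact hx rfl

/-- If every edge has an end without Dirichlet condition, there are arbitrarily large frequencies
at which the flux equations have a solution that is positive off the Dirichlet vertices. -/
theorem IsConnected.exists_pos_vertexFlux [Fintype V] {G : MetricGraph V E} (hG : G.IsConnected)
    {D : Set V} (hD : ∀ v ∈ D, ∀ e ∈ G.edgesAt v, ∀ f ∈ G.edgesAt v, e = f) (hDne : D.Nonempty)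
    (hDD : ∀ e, ¬ (G.init e ∈ D ∧ G.term e ∈ D)) [Nonempty E] (α : V → ℝ) (K : ℝ) :
    ∃ k, K < k ∧ 0 < k ∧ (∀ e, Real.sin (k * G.length e) ≠ 0) ∧ ∃ u : V → ℝ,
      (∀ v ∈ D, u v = 0) ∧ (∀ v ∉ D, 0 < u v) ∧ ∀ v ∉ D,
        G.vertexFlux (phaseCoeffs (fun e => k * G.length e, fun v => α v / k)) u v = 0 := by
  obtain ⟨e₁, he₁⟩ := Finite.exists_max G.length
  obtain ⟨e₂, he₂⟩ := Finite.exists_min G.length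
  have hM : 0 < G.length e₁ := G.length_pos e₁
  have hm : 0 < G.length e₂ := G.length_pos e₂
  have hpi := Real.pi_pos
  -- The indicator of an end off `D` is an admissible test function for the form.
  obtain ⟨v₁, hv₁, hv₁D⟩ : ∃ v, e₁ ∈ G.edgesAt v ∧ v ∉ D := by
    by_cases h : G.init e₁ ∈ D
    · exact ⟨_, G.mem_edgesAt.2 (.inr rfl), fun h' => hDD e₁ ⟨h, h'⟩⟩
    · exact ⟨_, G.mem_edgesAt.2 (.inl rfl), h⟩
  obtain ⟨κ₂, hκ₂, hκ₂', hneg⟩ := G.exists_vertexForm_neg he₁ hv₁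
  have hκ₂0 : 0 < κ₂ := pos_of_mul_pos_left ((half_pos hpi).trans_le hκ₂) hM.le
  obtain ⟨κ₁, hpos, hκ₁0, hκ₁₂⟩ := ((hG.vertexFormPos_small hDne).and
    (Ioo_mem_nhdsGT hκ₂0)).exists
  have hphase : ∀ κ ∈ Set.Icc κ₁ κ₂, ∀ e,
      κ₁ * G.length e₂ ≤ κ * G.length e ∧ κ * G.length e ≤ κ₂ * G.length e₁ := fun κ hκ e =>
    ⟨mul_le_mul hκ.1 (he₂ e) hm.le (hκ₁0.le.trans hκ.1),
      mul_le_mul hκ.2 (he₁ e) (G.length_pos e).le hκ₂0.le⟩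
  have hsin : ∀ κ ∈ Set.Icc κ₁ κ₂, ∀ e, Real.sin (κ * G.length e) ≠ 0 := fun κ hκ e =>
    (Real.sin_pos_of_pos_of_lt_pi ((mul_pos hκ₁0 hm).trans_le (hphase κ hκ e).1)
      ((hphase κ hκ e).2.trans_lt hκ₂')).ne'
  have hc : ∀ κ ∈ Set.Icc κ₁ κ₂,
      ContinuousAt phaseCoeffs ((fun e => κ * G.length e, 0) : (E → ℝ) × (V → ℝ)) := fun κ hκ =>
    continuousAt_phaseCoeffs (y := (fun e => κ * G.length e, 0)) (hsin κ hκ)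
  have h1 : ∀ᶠ y in 𝓝 ((fun e => κ₁ * G.length e, 0) : (E → ℝ) × (V → ℝ)),
      G.VertexFormPos D (phaseCoeffs y) :=
    (hc κ₁ ⟨le_rfl, hκ₁₂.le⟩).eventually hpos.eventually
  have h2 : ∀ᶠ y in 𝓝 ((fun e => κ₂ * G.length e, 0) : (E → ℝ) × (V → ℝ)),
      G.vertexForm (phaseCoeffs y) (Pi.single v₁ 1) < 0 := by
    exact (hc κ₂ ⟨hκ₁₂.le, le_rfl⟩).eventually
      ((G.continuous_vertexForm_left _).continuousAt.eventually_lt_const hneg)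
  obtain ⟨η₁, hη₁, hη₁'⟩ := Metric.eventually_nhds_iff.1 h1
  obtain ⟨η₂, hη₂, hη₂'⟩ := Metric.eventually_nhds_iff.1 h2
  -- The allowed perturbation keeps definiteness at `κ₁`, the negative value at `κ₂`, and all phases
  -- inside `(0, π)` in between.
  set η := min (min η₁ η₂) (min (κ₁ * G.length e₂) (Real.pi - κ₂ * G.length e₁)) with hη
  have hη0 : 0 < η := lt_min (lt_min hη₁ hη₂) (lt_min (mul_pos hκ₁0 hm) (sub_pos.2 hκ₂'))
  have hηa : η ≤ η₁ := (min_le_left _ _).trans (min_le_left _ _)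
  have hηb : η ≤ η₂ := (min_le_left _ _).trans (min_le_right _ _)
  have hηc : η ≤ κ₁ * G.length e₂ := (min_le_right _ _).trans (min_le_left _ _)
  have hηd : η ≤ Real.pi - κ₂ * G.length e₁ := (min_le_right _ _).trans (min_le_right _ _)
  set S := ∑ v, |α v| with hS
  have hS0 : 0 ≤ S := Finset.sum_nonneg fun v _ => abs_nonneg _
  have hSη : 0 ≤ S / η := by positivity
  obtain ⟨s, hs, hsm⟩ := exists_phases_near_zero G.length hη0 (|K| + 1 + S / η)
  choose n hn using hsm
  set δ : E → ℝ := fun e => s * G.length e - n e * (2 * Real.pi)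
  have hk : ∀ κ ∈ Set.Icc κ₁ κ₂, |K| + 1 + S / η ≤ s + κ := fun κ hκ => by
    linarith [hκ.1]
  have hk0 : ∀ κ ∈ Set.Icc κ₁ κ₂, 0 < s + κ := fun κ hκ => by
    linarith [hk κ hκ, abs_nonneg K]
  -- The true data at frequency `s + κ`, with phases reduced modulo `2π`: within `η` of the model at
  -- `κ` without couplings.
  let y : ℝ → (E → ℝ) × (V → ℝ) := fun κ => (fun e => κ * G.length e + δ e, fun v => α v / (s + κ))
  have hysin : ∀ κ ∈ Set.Icc κ₁ κ₂, ∀ e, 0 < Real.sin ((y κ).1 e) := fun κ hκ e => by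
    have h3 := hphase κ hκ e
    have h4 := abs_lt.1 (hn e)
    exact Real.sin_pos_of_pos_of_lt_pi (by change 0 < _ + δ e; linarith)
      (by change _ + δ e < _; linarith)
  have hyc : ContinuousOn (fun κ => phaseCoeffs (y κ)) (Set.Icc κ₁ κ₂) := by
    intro κ hκ
    have hy1 : ContinuousAt (fun κ e => κ * G.length e + δ e) κ := by fun_prop
    have hy2 : ContinuousAt (fun κ v => α v / (s + κ)) κ := continuousAt_pi.2 fun v =>
      continuousAt_const.div (by fun_prop) (hk0 κ hκ).ne'
    have hy3 : ContinuousAt y κ := hy1.prodMk hy2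
    have hy4 : ContinuousAt phaseCoeffs (y κ) :=
      continuousAt_phaseCoeffs fun e => (hysin κ hκ e).ne'
    exact (ContinuousAt.comp (f := y) (g := phaseCoeffs) hy4 hy3).continuousWithinAt
  have hydist : ∀ κ ∈ Set.Icc κ₁ κ₂,
      dist (y κ) ((fun e => κ * G.length e, 0) : (E → ℝ) × (V → ℝ)) < η := by
    intro κ hκ
    rw [Prod.dist_eq]
    refine max_lt ((dist_pi_lt_iff hη0).2 fun e => ?_) ((dist_pi_lt_iff hη0).2 fun v => ?_)
    · change |κ * G.length e + δ e - κ * G.length e| < η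
      rw [add_sub_cancel_left]
      exact hn e
    · change |α v / (s + κ) - 0| < η
      rw [sub_zero, abs_div, abs_of_pos (hk0 κ hκ), div_lt_iff₀ (hk0 κ hκ)]
      have h3 : |α v| ≤ S := Finset.single_le_sum (f := fun v => |α v|)
        (fun v _ => abs_nonneg _) (Finset.mem_univ v)
      have h4 : 1 + S / η ≤ s + κ := by linarith [hk κ hκ, abs_nonneg K]
      have h5 := mul_le_mul_of_nonneg_left h4 hη0.le
      have h6 : η * (1 + S / η) = η + S := by field_simp
      linarith
  have hl : κ₁ ∈ Set.Icc κ₁ κ₂ := ⟨le_rfl, hκ₁₂.le⟩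
  have hr : κ₂ ∈ Set.Icc κ₁ κ₂ := ⟨hκ₁₂.le, le_rfl⟩
  obtain ⟨κ, hκ, u, huD, hupos, huf⟩ := hG.exists_pos_kernel hD hκ₁₂.le hyc
    (fun κ hκ e => inv_pos.2 (hysin κ hκ e)) (hη₁' ((hydist κ₁ hl).trans_le hηa))
    (w := Pi.single v₁ 1) (fun v hv => Pi.single_eq_of_ne (ne_of_mem_of_not_mem hv hv₁D) _)
    (hη₂' ((hydist κ₂ hr).trans_le hηb))
  have hperiod : ∀ e, (s + κ) * G.length e = (y κ).1 e + n e * (2 * Real.pi) := fun e => by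
    simp only [y, δ]
    ring
  have hsin' : ∀ e, Real.sin ((s + κ) * G.length e) = Real.sin ((y κ).1 e) := fun e => by
    rw [hperiod, Real.sin_add_int_mul_two_pi]
  have hcos' : ∀ e, Real.cos ((s + κ) * G.length e) = Real.cos ((y κ).1 e) := fun e => by
    rw [hperiod, Real.cos_add_int_mul_two_pi]
  have hcoef : phaseCoeffs (fun e => (s + κ) * G.length e, fun v => α v / (s + κ)) =
      phaseCoeffs (y κ) := by
    simp only [phaseCoeffs, hsin', hcos']
    rfl
  refine ⟨s + κ, by linarith [hk κ hκ, le_abs_self K], hk0 κ hκ, fun e => ?_, u, huD, hupos, ?_⟩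
  · rw [hsin']
    exact (hysin κ hκ e).ne'
  · rw [hcoef]
    exact huf

/-- A connected graph with Dirichlet conditions at some vertices of degree one has arbitrarily large
eigenvalues with eigenfunctions of full support. -/
theorem IsConnected.exists_fullSupport_eigenfunction [Fintype V] {G : MetricGraph V E}
    (hG : G.IsConnected) {bc : V → VertexCondition}
    (hdeg : ∀ v, bc v = .dirichlet → G.degree v = 1) (hex : ∃ v, bc v = .dirichlet) (K : ℝ) :
    ∃ lam, K < lam ∧ ∃ ψ : G.EdgeFun, G.IsEigenfunction bc lam ψ ∧ G.HasFullSupport ψ := by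
  set D : Set V := {v | bc v = .dirichlet}
  have hD : ∀ v ∈ D, ∀ e ∈ G.edgesAt v, ∀ f ∈ G.edgesAt v, e = f := fun v hv e he f hf =>
    Finset.card_le_one.1 (hdeg v hv).le e he f hf
  obtain ⟨v₀, hv₀⟩ := hex
  obtain ⟨e₀, -⟩ : (G.edgesAt v₀).Nonempty := by
    rw [← Finset.card_pos]
    exact one_pos.trans_eq (hdeg v₀ hv₀).symm
  have : Nonempty E := ⟨e₀⟩
  -- An edge with two Dirichlet ends carries no nonzero vertex value; by the degree condition it is
  -- then the whole graph.
  by_cases hDD : ∃ e, G.init e ∈ D ∧ G.term e ∈ D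
  · obtain ⟨e, hi, ht⟩ := hDD
    obtain ⟨hE, hV⟩ := hG.eq_of_degree_one hD hi ht
    refine G.exists_eigenfunction_interval hE (fun v => ?_) K
    rcases hV v with rfl | rfl
    · exact hi
    · exact ht
  · rw [not_exists] at hDD
    obtain ⟨k, hkK, hk, hs, u, huD, hupos, huf⟩ := hG.exists_pos_vertexFlux hD ⟨v₀, hv₀⟩ hDD
      (fun v => coupling (bc v)) (max K 1)
    obtain ⟨ψ, hψ, hval⟩ := G.exists_mem_eigenspace_of_vertexFlux hk hs huD huf
    have hk1 : 1 < k := (le_max_right _ _).trans_lt hkK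
    have hfull : G.HasFullSupport ψ := by
      intro e
      by_cases hi : G.init e ∈ D
      · have ht : G.term e ∉ D := fun h => hDD e ⟨hi, h⟩
        have h1 := hval _ e (G.mem_edgesAt.2 (.inr rfl))
        rw [valueAt, if_neg (G.init_ne_term e), onEdge, Set.IccExtend_right] at h1
        exact ⟨_, h1.trans_ne (hupos _ ht).ne'⟩
      · have h1 := hval _ e (G.mem_edgesAt.2 (.inl rfl))
        rw [valueAt, if_pos rfl, onEdge, Set.IccExtend_left] at h1
        exact ⟨_, h1.trans_ne (hupos _ hi).ne'⟩
    refine ⟨k ^ 2, ?_, ψ, ⟨hψ, fun h => ?_⟩, hfull⟩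
    · have := (le_max_left K 1).trans_lt hkK
      nlinarith
    · obtain ⟨x, hx⟩ := hfull e₀
      rw [h] at hx
      exact hx rfl

end

end MetricGraph

theorem theorem3 {V E : Type*} [Fintype V] [Fintype E] [DecidableEq V]
    (G : MetricGraph V E) (bc : V → VertexCondition) :
    (G.IsTree → Nonempty E → (∀ v, bc v ≠ VertexCondition.dirichlet) →
      ∃ (lam : ℕ → ℝ) (ψ : ℕ → G.EdgeFun), StrictMono lam ∧
        ∀ k, G.IsEigenfunction bc (lam k) (ψ k) ∧ G.multiplicity bc (lam k) = 1 ∧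
          ∀ v, G.NonzeroAt (ψ k) v) ∧
    (G.IsConnected → (∀ v, bc v = VertexCondition.dirichlet → G.degree v = 1) →
      (∃ v, bc v = VertexCondition.dirichlet) →
      ∃ (lam : ℕ → ℝ) (ψ : ℕ → G.EdgeFun), StrictMono lam ∧
        ∀ k, G.IsEigenfunction bc (lam k) (ψ k) ∧ G.HasFullSupport (ψ k)) := by
  refine ⟨fun hG hE hbc => ?_, fun hG hdeg hex => ?_⟩
  · obtain ⟨lam, hlam, h⟩ := exists_strictMono_of_unbounded fun K => hG.exists_simple_eigenvalue hbc K
    choose ψ hψ using h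
    exact ⟨lam, ψ, hlam, hψ⟩
  · obtain ⟨lam, hlam, h⟩ := exists_strictMono_of_unbounded fun K =>
      hG.exists_fullSupport_eigenfunction hdeg hex K
    choose ψ hψ using h
    exact ⟨lam, ψ, hlam, hψ⟩
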